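/- Let $\|\cdot\|$ be an arbitrary norm on $\mathbb{R}^m$ with dual norm $\|z\|_* = \sup_{\|\xi\|\le 1}\langle z,\xi\rangle$, let $C\in\mathbb{R}^{p\times m}$, $d\in\mathbb{R}^p$, and let $\Xi=\{\xi\in\mathbb{R}^m : C\xi\le d\}$ (not necessarily bounded). Let $\mathcal{M}(\Xi)$ be the set of probability distributions $\mathbb{Q}$ supported on $\Xi$ with $\mathbb{E}^{\mathbb{Q}}[\|\xi\|]<\infty$, and let $$d_W(\mathbb{Q}_1,\mathbb{Q}_2)=\inf_{\Pi}\int\|\xi_1-\xi_2\|\,\Pi(\mathrm{d}\xi_1,\mathrm{d}\xi_2),$$ where $\Pi$ ranges over the joint distributions with marginals $\mathbb{Q}_1$ and $\mathbb{Q}_2$. Let $N,K\ge 1$, let $\hat\xi_1,\dots,\hat\xi_N\in\Xi$, let $\hat{\mathbb{P}}_N=\frac1N\sum_{i=1}^N\delta_{\hat\xi_i}$, let $\varepsilon\ge 0$, and let $\mathbb{B}_\varepsilon=\{\mathbb{Q}\in\mathcal{M}(\Xi): d_W(\hat{\mathbb{P}}_N,\mathbb{Q})\le\varepsilon\}$.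 Let $a_k\in\mathbb{R}^m$ and $b_k\in\mathbb{R}$ for $k\le K$, let $A$ be the matrix with rows $a_k^\top$, $b=(b_k)_{k\le K}$, and let $e$ be the vector of ones. (i) If $\ell(\xi)=\max_{k\le K}(\langle a_k,\xi\rangle+b_k)$, then $\ell$ is integrable under every $\mathbb{Q}\in\mathbb{B}_\varepsilon$, and $\sup_{\mathbb{Q}\in\mathbb{B}_\varepsilon}\mathbb{E}^{\mathbb{Q}}[\ell(\xi)]$ equals the optimal value of $$\begin{array}{cll}\inf\limits_{\lambda,s_i,\gamma_{ik}} & \lambda\varepsilon+\frac1N\sum_{i=1}^N s_i\\ \text{s.t.} & b_k+\langle a_k,\hat\xi_i\rangle+\langle\gamma_{ik},d-C\hat\xi_i\rangle\le s_i & \forall i\le N,\ k\le K\\ & \|C^\top\gamma_{ik}-a_k\|_*\le\lambda & \forall i\le N,\ k\le K\\ & \gamma_{ik}\ge 0 & \forall i\le N,\ k\le K,\end{array}$$ where $\lambda,s_i\in\mathbb{R}$ and $\gamma_{ik}\in\mathbb{R}^p$. (ii) If $\ell(\xi)=\min_{k\le K}(\langle a_k,\xi\rangle+b_k)$, then $\ell$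 is integrable under every $\mathbb{Q}\in\mathbb{B}_\varepsilon$, and $\sup_{\mathbb{Q}\in\mathbb{B}_\varepsilon}\mathbb{E}^{\mathbb{Q}}[\ell(\xi)]$ equals the optimal value of $$\begin{array}{cll}\inf\limits_{\lambda,s_i,\gamma_i,\theta_i} & \lambda\varepsilon+\frac1N\sum_{i=1}^N s_i\\ \text{s.t.} & \langle\theta_i,b+A\hat\xi_i\rangle+\langle\gamma_i,d-C\hat\xi_i\rangle\le s_i & \forall i\le N\\ & \|C^\top\gamma_i-A^\top\theta_i\|_*\le\lambda & \forall i\le N\\ & \langle\theta_i,e\rangle=1,\ \gamma_i\ge 0,\ \theta_i\ge 0 & \forall i\le N,\end{array}$$ where $\lambda,s_i\in\mathbb{R}$, $\gamma_i\in\mathbb{R}^p$ and $\theta_i\in\mathbb{R}^K$. (iii) If $\|\cdot\|$ is the $1$-norm or the $\infty$-norm, both programs reduce to explicit linear programs with the same optimal values. Write $v$ for $C^\top\gamma_{ik}-a_k$ in (i) and for $C^\top\gamma_i-A^\top\theta_i$ in (ii). For the $1$-norm, replacing each constraint $\|v\|_*\le\lambda$ by $\pm v_l\le\lambda$ ($l\le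 m$) and adding $\lambda\ge 0$ gives a linear program in the same variables with the same feasible set and objective. For the $\infty$-norm, replacing each constraint $\|v\|_*\le\lambda$ by $\pm v_l\le u_l$ ($l\le m$) and $\sum_{l\le m}u_l\le\lambda$, with a separate auxiliary vector $u\in\mathbb{R}^m$ for each such constraint, gives a linear program with the same objective, whose feasible set projects onto that of the original program. Counting each equation as two inequalities, for the $1$-norm these linear programs have $1+N+NKp$ variables and $NK(1+2m+p)+1$ inequalities in case (i), and $1+N(1+p+K)$ variables and $N(3+2m+p+K)+1$ inequalities in case (ii). For the $\infty$-norm they have $1+N+NK(p+m)$ variables and $NK(2+2m+p)$ inequalities in case (i), and $1+N(1+p+K+m)$ variables and $N(4+2m+p+K)$ inequalities in case (ii). -/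

import Mathlib

open MeasureTheory Matrix
open scoped ENNReal

namespace WassersteinDRO

noncomputable section

/-- The polyhedron `{ξ ∈ ℝᵐ : C ξ ≤ d}`. -/
def polytope {m p : ℕ} (C : Matrix (Fin p) (Fin m) ℝ) (d : Fin p → ℝ) : Set (Fin m → ℝ) :=
  {ξ | C *ᵥ ξ ≤ d}

/-- The dual norm `‖z‖_* = sup {⟨z, ξ⟩ : ‖ξ‖ ≤ 1}`. -/
def dualNorm {m : ℕ} (nrm : Seminorm ℝ (Fin m → ℝ)) (z : Fin m → ℝ) : ℝ :=
  sSup ((fun ξ : Fin m → ℝ => z ⬝ᵥ ξ) '' {ξ | nrm ξ ≤ 1})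

/-- The space `M(Ξ)` of probability distributions supported on `Ξ` with finite first moment. -/
def firstMomentMeasures {m : ℕ} (nrm : Seminorm ℝ (Fin m → ℝ)) (Ξ : Set (Fin m → ℝ)) :
    Set (Measure (Fin m → ℝ)) :=
  {Q | IsProbabilityMeasure Q ∧ Q Ξᶜ = 0 ∧ ∫⁻ x, ENNReal.ofReal (nrm x) ∂Q < ∞}

/-- The 1-Wasserstein distance with transportation cost `‖x - y‖`. -/
def wassersteinDist {m : ℕ} (nrm : Seminorm ℝ (Fin m → ℝ)) (Q₁ Q₂ : Measure (Fin m → ℝ)) :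
    ℝ≥0∞ :=
  ⨅ π ∈ {π : Measure ((Fin m → ℝ) × (Fin m → ℝ)) |
      π.map Prod.fst = Q₁ ∧ π.map Prod.snd = Q₂},
    ∫⁻ z, ENNReal.ofReal (nrm (z.1 - z.2)) ∂π

/-- The empirical distribution `(1/N) ∑ᵢ δ_{ξᵢ}`. -/
def empirical {m N : ℕ} (ξ : Fin N → Fin m → ℝ) : Measure (Fin m → ℝ) :=
  (N : ℝ≥0∞)⁻¹ • ∑ i, Measure.dirac (ξ i)

/-- The Wasserstein ball in `M(Ξ)` of radius `ε` around the empirical distribution. -/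
def wassersteinBall {m N : ℕ} (nrm : Seminorm ℝ (Fin m → ℝ)) (Ξ : Set (Fin m → ℝ))
    (ξ : Fin N → Fin m → ℝ) (ε : ℝ) : Set (Measure (Fin m → ℝ)) :=
  {Q | Q ∈ firstMomentMeasures nrm Ξ ∧
    wassersteinDist nrm (empirical ξ) Q ≤ ENNReal.ofReal ε}

/-- The worst-case expectation of `ℓ` over the Wasserstein ball. -/
def worstCase {m N : ℕ} (nrm : Seminorm ℝ (Fin m → ℝ)) (Ξ : Set (Fin m → ℝ))
    (ξ : Fin N → Fin m → ℝ) (ε : ℝ) (ℓ : (Fin m → ℝ) → ℝ) : EReal :=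
  ⨆ Q ∈ wassersteinBall nrm Ξ ξ ε, ((∫ x, ℓ x ∂Q : ℝ) : EReal)

/-- `max_k (⟨a_k, x⟩ + b_k)`, where `a_k` is the `k`-th row of `A`. -/
def maxAffine {m K : ℕ} (A : Matrix (Fin K) (Fin m) ℝ) (b : Fin K → ℝ) (x : Fin m → ℝ) : ℝ :=
  ⨆ k, (A k ⬝ᵥ x + b k)

/-- `min_k (⟨a_k, x⟩ + b_k)`, where `a_k` is the `k`-th row of `A`. -/
def minAffine {m K : ℕ} (A : Matrix (Fin K) (Fin m) ℝ) (b : Fin K → ℝ) (x : Fin m → ℝ) : ℝ :=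
  ⨅ k, (A k ⬝ᵥ x + b k)

/-- The optimal value of the minimization of `f` over the feasible set `F`. -/
def optValue {E : Type*} (F : Set E) (f : E → ℝ) : EReal :=
  ⨅ x ∈ F, (f x : EReal)

/-! ### The two finite-dimensional programs -/

/-- Decision variables `(λ, s, γ)` with `λ ∈ ℝ`, `s ∈ ℝᴺ` and `γ i k ∈ ℝᵖ`. -/
abbrev MaxVars (N K p : ℕ) : Type :=
  ℝ × (Fin N → ℝ) × (Fin N → Fin K → Fin p → ℝ)

/-- Decision variables `(λ, s, γ, θ)` with `λ ∈ ℝ`, `s ∈ ℝᴺ`, `γ i ∈ ℝᵖ` and `θ i ∈ ℝᴷ`. -/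
abbrev MinVars (N K p : ℕ) : Type :=
  ℝ × (Fin N → ℝ) × (Fin N → Fin p → ℝ) × (Fin N → Fin K → ℝ)

/-- The objective `λ ε + (1/N) ∑ᵢ sᵢ`, where the further variables `y` do not enter. -/
def objective {N : ℕ} {Y : Type*} (ε : ℝ) (x : ℝ × (Fin N → ℝ) × Y) : ℝ :=
  x.1 * ε + (1 / (N : ℝ)) * ∑ i, x.2.1 i

/-- The feasible set of the program for the loss `max_k (⟨a_k, x⟩ + b_k)`. -/
def maxFeasible {m p N K : ℕ} (nrm : Seminorm ℝ (Fin m → ℝ))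
    (C : Matrix (Fin p) (Fin m) ℝ) (d : Fin p → ℝ)
    (A : Matrix (Fin K) (Fin m) ℝ) (b : Fin K → ℝ) (ξ : Fin N → Fin m → ℝ) :
    Set (MaxVars N K p) :=
  {(lam, s, γ) |
    (∀ i k, b k + A k ⬝ᵥ ξ i + γ i k ⬝ᵥ (d - C *ᵥ ξ i) ≤ s i) ∧
    (∀ i k, dualNorm nrm (Cᵀ *ᵥ γ i k - A k) ≤ lam) ∧
    (∀ i k, 0 ≤ γ i k)}

/-- The feasible set of the program for the loss `min_k (⟨a_k, x⟩ + b_k)`. -/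
def minFeasible {m p N K : ℕ} (nrm : Seminorm ℝ (Fin m → ℝ))
    (C : Matrix (Fin p) (Fin m) ℝ) (d : Fin p → ℝ)
    (A : Matrix (Fin K) (Fin m) ℝ) (b : Fin K → ℝ) (ξ : Fin N → Fin m → ℝ) :
    Set (MinVars N K p) :=
  {(lam, s, γ, θ) |
    (∀ i, θ i ⬝ᵥ (b + A *ᵥ ξ i) + γ i ⬝ᵥ (d - C *ᵥ ξ i) ≤ s i) ∧
    (∀ i, dualNorm nrm (Cᵀ *ᵥ γ i - Aᵀ *ᵥ θ i) ≤ lam) ∧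
    (∀ i, θ i ⬝ᵥ 1 = 1) ∧
    (∀ i, 0 ≤ γ i) ∧
    (∀ i, 0 ≤ θ i)}

/-! ### Linear programs -/

/-- A linear program: minimize the linear form `cost x` over all `x` in the real vector space `E`
subject to the linear inequalities `lhs x r ≤ rhs r`, `r ∈ R`. -/
structure LinearProgram (E R : Type) [AddCommGroup E] [Module ℝ E] where
  cost : E →ₗ[ℝ] ℝ
  lhs : E →ₗ[ℝ] (R → ℝ)
  rhs : R → ℝ

namespace LinearProgram

variable {E R : Type} [AddCommGroup E] [Module ℝ E]

def feasible (L : LinearProgram E R) : Set E := {x | L.lhs x ≤ L.rhs}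

def value (L : LinearProgram E R) : EReal := optValue L.feasible L.cost

/-- The number of real decision variables. -/
def numVars (_ : LinearProgram E R) : ℕ := Module.finrank ℝ E

/-- The number of linear inequality constraints. -/
def numCons (_ : LinearProgram E R) : ℕ := Nat.card R

end LinearProgram

/-- The sign `+1` or `-1`. -/
def sgn (σ : Bool) : ℝ := if σ then 1 else -1

/-- `objective` as a linear form. -/
def objectiveLin {N : ℕ} {Y : Type} [AddCommGroup Y] [Module ℝ Y] (ε : ℝ) :
    (ℝ × (Fin N → ℝ) × Y) →ₗ[ℝ] ℝ where
  toFun := objective ε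
  map_add' x y := by
    simp only [objective, Prod.fst_add, Prod.snd_add, Pi.add_apply, Finset.sum_add_distrib]
    ring
  map_smul' c x := by
    simp only [objective, Prod.smul_fst, Prod.smul_snd, Pi.smul_apply, smul_eq_mul,
      ← Finset.mul_sum, RingHom.id_apply]
    ring

/-- The linear program for `max_k (⟨a_k, x⟩ + b_k)` and the 1-norm, in the variables `(λ, s, γ)`.
Its constraints, in this order, are
* `⟨γᵢₖ, d - C ξᵢ⟩ - sᵢ ≤ -(b_k + ⟨a_k, ξᵢ⟩)`,
* `± (Cᵀ γᵢₖ)ₗ - λ ≤ ± (a_k)ₗ`,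
* `-(γᵢₖ)ⱼ ≤ 0`,
* `-λ ≤ 0`. -/
def maxLPOne {m p N K : ℕ} (C : Matrix (Fin p) (Fin m) ℝ) (d : Fin p → ℝ)
    (A : Matrix (Fin K) (Fin m) ℝ) (b : Fin K → ℝ) (ξ : Fin N → Fin m → ℝ) (ε : ℝ) :
    LinearProgram (MaxVars N K p)
      ((Fin N × Fin K) ⊕ (Fin N × Fin K × Fin m × Bool) ⊕ (Fin N × Fin K × Fin p) ⊕ Unit) where
  cost := objectiveLin ε
  lhs :=
    { toFun := fun (lam, s, γ) r => match r with
        | .inl (i, k) => γ i k ⬝ᵥ (d - C *ᵥ ξ i) - s i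
        | .inr (.inl (i, k, l, σ)) => sgn σ * (Cᵀ *ᵥ γ i k) l - lam
        | .inr (.inr (.inl (i, k, j))) => - γ i k j
        | .inr (.inr (.inr ())) => - lam
      map_add' := by
        rintro ⟨_, _, _⟩ ⟨_, _, _⟩
        ext (⟨_, _⟩ | ⟨_, _, _, _⟩ | ⟨_, _, _⟩ | _) <;>
          simp [add_dotProduct, mulVec_add] <;> ring
      map_smul' := by
        rintro _ ⟨_, _, _⟩
        ext (⟨_, _⟩ | ⟨_, _, _, _⟩ | ⟨_, _, _⟩ | _) <;>
          simp [smul_dotProduct, mulVec_smul] <;> ring }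
  rhs := fun r => match r with
    | .inl (i, k) => -(b k + A k ⬝ᵥ ξ i)
    | .inr (.inl (_, k, l, σ)) => sgn σ * A k l
    | .inr (.inr (.inl _)) => 0
    | .inr (.inr (.inr _)) => 0

/-- The linear program for `max_k (⟨a_k, x⟩ + b_k)` and the ∞-norm, in the variables `(λ, s, γ)`
and the auxiliary variables `u i k ∈ ℝᵐ`. Its constraints, in this order, are
* `⟨γᵢₖ, d - C ξᵢ⟩ - sᵢ ≤ -(b_k + ⟨a_k, ξᵢ⟩)`,
* `± (Cᵀ γᵢₖ)ₗ - (uᵢₖ)ₗ ≤ ± (a_k)ₗ`,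
* `-(γᵢₖ)ⱼ ≤ 0`,
* `∑ₗ (uᵢₖ)ₗ - λ ≤ 0`. -/
def maxLPInf {m p N K : ℕ} (C : Matrix (Fin p) (Fin m) ℝ) (d : Fin p → ℝ)
    (A : Matrix (Fin K) (Fin m) ℝ) (b : Fin K → ℝ) (ξ : Fin N → Fin m → ℝ) (ε : ℝ) :
    LinearProgram (MaxVars N K p × (Fin N → Fin K → Fin m → ℝ))
      ((Fin N × Fin K) ⊕ (Fin N × Fin K × Fin m × Bool) ⊕ (Fin N × Fin K × Fin p) ⊕
        (Fin N × Fin K)) where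
  cost := objectiveLin ε ∘ₗ LinearMap.fst ℝ _ _
  lhs :=
    { toFun := fun ((lam, s, γ), u) r => match r with
        | .inl (i, k) => γ i k ⬝ᵥ (d - C *ᵥ ξ i) - s i
        | .inr (.inl (i, k, l, σ)) => sgn σ * (Cᵀ *ᵥ γ i k) l - u i k l
        | .inr (.inr (.inl (i, k, j))) => - γ i k j
        | .inr (.inr (.inr (i, k))) => ∑ l, u i k l - lam
      map_add' := by
        rintro ⟨⟨_, _, _⟩, _⟩ ⟨⟨_, _, _⟩, _⟩
        ext (⟨_, _⟩ | ⟨_, _, _, _⟩ | ⟨_, _, _⟩ | ⟨_, _⟩) <;>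
          simp [add_dotProduct, mulVec_add, Finset.sum_add_distrib] <;> ring
      map_smul' := by
        rintro _ ⟨⟨_, _, _⟩, _⟩
        ext (⟨_, _⟩ | ⟨_, _, _, _⟩ | ⟨_, _, _⟩ | ⟨_, _⟩) <;>
          simp [smul_dotProduct, mulVec_smul, ← Finset.mul_sum] <;> ring }
  rhs := fun r => match r with
    | .inl (i, k) => -(b k + A k ⬝ᵥ ξ i)
    | .inr (.inl (_, k, l, σ)) => sgn σ * A k l
    | .inr (.inr (.inl _)) => 0
    | .inr (.inr (.inr _)) => 0

/-- The linear program for `min_k (⟨a_k, x⟩ + b_k)` and the 1-norm, in the variables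
`(λ, s, γ, θ)`. Its constraints, in this order, are
* `⟨θᵢ, b + A ξᵢ⟩ + ⟨γᵢ, d - C ξᵢ⟩ - sᵢ ≤ 0`,
* `± (Cᵀ γᵢ - Aᵀ θᵢ)ₗ - λ ≤ 0`,
* `± ⟨θᵢ, e⟩ ≤ ± 1`,
* `-(γᵢ)ⱼ ≤ 0`,
* `-(θᵢ)ₖ ≤ 0`,
* `-λ ≤ 0`. -/
def minLPOne {m p N K : ℕ} (C : Matrix (Fin p) (Fin m) ℝ) (d : Fin p → ℝ)
    (A : Matrix (Fin K) (Fin m) ℝ) (b : Fin K → ℝ) (ξ : Fin N → Fin m → ℝ) (ε : ℝ) :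
    LinearProgram (MinVars N K p)
      (Fin N ⊕ (Fin N × Fin m × Bool) ⊕ (Fin N × Bool) ⊕ (Fin N × Fin p) ⊕
        (Fin N × Fin K) ⊕ Unit) where
  cost := objectiveLin ε
  lhs :=
    { toFun := fun (lam, s, γ, θ) r => match r with
        | .inl i => θ i ⬝ᵥ (b + A *ᵥ ξ i) + γ i ⬝ᵥ (d - C *ᵥ ξ i) - s i
        | .inr (.inl (i, l, σ)) => sgn σ * (Cᵀ *ᵥ γ i - Aᵀ *ᵥ θ i) l - lam
        | .inr (.inr (.inl (i, σ))) => sgn σ * (θ i ⬝ᵥ 1)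
        | .inr (.inr (.inr (.inl (i, j)))) => - γ i j
        | .inr (.inr (.inr (.inr (.inl (i, k))))) => - θ i k
        | .inr (.inr (.inr (.inr (.inr ())))) => - lam
      map_add' := by
        rintro ⟨_, _, _, _⟩ ⟨_, _, _, _⟩
        ext (_ | ⟨_, _, _⟩ | ⟨_, _⟩ | ⟨_, _⟩ | ⟨_, _⟩ | _) <;>
          simp only [Pi.add_apply, add_dotProduct, mulVec_add,
            Pi.sub_apply] <;> ring
      map_smul' := by
        rintro _ ⟨_, _, _, _⟩
        ext (_ | ⟨_, _, _⟩ | ⟨_, _⟩ | ⟨_, _⟩ | ⟨_, _⟩ | _) <;>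
          simp only [Pi.smul_apply, Prod.smul_mk, smul_dotProduct, mulVec_smul,
            Pi.sub_apply, smul_eq_mul, RingHom.id_apply] <;> ring }
  rhs := fun r => match r with
    | .inr (.inr (.inl (_, σ))) => sgn σ
    | _ => 0

/-- The linear program for `min_k (⟨a_k, x⟩ + b_k)` and the ∞-norm, in the variables
`(λ, s, γ, θ)` and the auxiliary variables `u i ∈ ℝᵐ`. Its constraints, in this order, are
* `⟨θᵢ, b + A ξᵢ⟩ + ⟨γᵢ, d - C ξᵢ⟩ - sᵢ ≤ 0`,
* `± (Cᵀ γᵢ - Aᵀ θᵢ)ₗ - (uᵢ)ₗ ≤ 0`,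
* `± ⟨θᵢ, e⟩ ≤ ± 1`,
* `-(γᵢ)ⱼ ≤ 0`,
* `-(θᵢ)ₖ ≤ 0`,
* `∑ₗ (uᵢ)ₗ - λ ≤ 0`. -/
def minLPInf {m p N K : ℕ} (C : Matrix (Fin p) (Fin m) ℝ) (d : Fin p → ℝ)
    (A : Matrix (Fin K) (Fin m) ℝ) (b : Fin K → ℝ) (ξ : Fin N → Fin m → ℝ) (ε : ℝ) :
    LinearProgram (MinVars N K p × (Fin N → Fin m → ℝ))
      (Fin N ⊕ (Fin N × Fin m × Bool) ⊕ (Fin N × Bool) ⊕ (Fin N × Fin p) ⊕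
        (Fin N × Fin K) ⊕ Fin N) where
  cost := objectiveLin ε ∘ₗ LinearMap.fst ℝ _ _
  lhs :=
    { toFun := fun ((lam, s, γ, θ), u) r => match r with
        | .inl i => θ i ⬝ᵥ (b + A *ᵥ ξ i) + γ i ⬝ᵥ (d - C *ᵥ ξ i) - s i
        | .inr (.inl (i, l, σ)) => sgn σ * (Cᵀ *ᵥ γ i - Aᵀ *ᵥ θ i) l - u i l
        | .inr (.inr (.inl (i, σ))) => sgn σ * (θ i ⬝ᵥ 1)
        | .inr (.inr (.inr (.inl (i, j)))) => - γ i j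
        | .inr (.inr (.inr (.inr (.inl (i, k))))) => - θ i k
        | .inr (.inr (.inr (.inr (.inr i)))) => ∑ l, u i l - lam
      map_add' := by
        rintro ⟨⟨_, _, _, _⟩, _⟩ ⟨⟨_, _, _, _⟩, _⟩
        ext (_ | ⟨_, _, _⟩ | ⟨_, _⟩ | ⟨_, _⟩ | ⟨_, _⟩ | _) <;>
          simp only [Pi.add_apply, add_dotProduct, mulVec_add,
            Pi.sub_apply, Finset.sum_add_distrib] <;> ring
      map_smul' := by
        rintro _ ⟨⟨_, _, _, _⟩, _⟩
        ext (_ | ⟨_, _, _⟩ | ⟨_, _⟩ | ⟨_, _⟩ | ⟨_, _⟩ | _) <;>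
          simp only [Pi.smul_apply, Prod.smul_mk, smul_dotProduct, mulVec_smul,
            Pi.sub_apply, smul_eq_mul, RingHom.id_apply, ← Finset.mul_sum] <;> ring }
  rhs := fun r => match r with
    | .inr (.inr (.inl (_, σ))) => sgn σ
    | _ => 0

end

end WassersteinDRO

open WassersteinDRO

/-!
Let `v(r)` be the worst-case expectation over the ball of radius `r`. If `λ ≥ 0` and
`ℓ x ≤ sᵢ + λ ‖x - ξᵢ‖` on `Ξ`, then integrating this inequality against a coupling of the empirical
measure and `Q` bounds `E^Q[ℓ]` by the dual objective.

For the converse, mixing measures shows that `v` is concave on `[0, ∞)`; since `ℓ` is Lipschitz, `v`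
grows at most linearly, so it has a nonnegative supergradient `λ` at `ε`, also when `ε = 0`. Testing
the supergradient inequality on the empirical measures of arbitrary points `y₁, …, y_N` of `Ξ`
bounds `∑ᵢ (ℓ(yᵢ) - λ ‖yᵢ - ξᵢ‖)`; as the `yᵢ` vary independently, this bound splits into the
numbers `sᵢ`, and `(λ, s)` attains `v(ε)`.

For a piecewise affine loss, each semi-infinite constraint says that a concave function is at most
`sᵢ` on the polyhedron `Ξ`. Farkas multipliers for the inequalities of `Ξ` and of the hypograph of
the loss make it a finite system, and the sublinear term `λ ‖x - ξᵢ‖` becomes a bound on the dual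
norm. The `1`-norm and the `∞`-norm have each other as dual norm, which gives the linear programs.
-/

namespace WassersteinDRO

section Farkas

variable {𝕜 V ι : Type*} [Field 𝕜] [LinearOrder 𝕜] [IsStrictOrderedRing 𝕜]
  [AddCommGroup V] [Module 𝕜 V]

theorem slope_le_of_forall_add_mul_le {r s α v : 𝕜} (h : ∀ t, 0 ≤ t → α + t * r ≤ v + t * s) :
    r ≤ s := by
  by_contra! hlt
  have hpos : 0 < r - s := sub_pos.2 hlt
  have hbound := h ((|v - α| + 1) / (r - s)) (by positivity)
  have hgap : (|v - α| + 1) / (r - s) * r - (|v - α| + 1) / (r - s) * s = |v - α| + 1 := by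
    rw [← mul_sub, div_mul_cancel₀ _ hpos.ne']
  linarith [le_abs_self (v - α)]

theorem exists_normalized_direction {s : Finset ι} {a : ι} {c : ι → Module.Dual 𝕜 V}
    {w : Module.Dual 𝕜 V} (hinsert : ∀ x, c a x ≤ 0 → (∀ j ∈ s, c j x ≤ 0) → w x ≤ 0)
    (hs : ¬ ∀ x, (∀ j ∈ s, c j x ≤ 0) → w x ≤ 0) :
    ∃ y, c a y = 1 ∧ (∀ j ∈ s, c j y ≤ 0) ∧ 0 ≤ w y := by
  push Not at hs
  obtain ⟨x, hx, hwx⟩ := hs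
  have hax : 0 < c a x := not_le.1 fun hax => (hinsert x hax hx).not_gt hwx
  refine ⟨(c a x)⁻¹ • x, ?_, fun j hj => ?_, ?_⟩
  · rw [map_smul, smul_eq_mul, inv_mul_cancel₀ hax.ne']
  · rw [map_smul]
    exact smul_nonpos_of_nonneg_of_nonpos (inv_nonneg.2 hax.le) (hx j hj)
  · rw [map_smul]
    exact smul_nonneg (inv_nonneg.2 hax.le) hwx.le

theorem exists_nonneg_eq_sum_smul_of_forall_nonpos (s : Finset ι) (c : ι → Module.Dual 𝕜 V)
    (w : Module.Dual 𝕜 V) (h : ∀ x, (∀ j ∈ s, c j x ≤ 0) → w x ≤ 0) :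
    ∃ u : ι → 𝕜, (∀ j, 0 ≤ u j) ∧ w = ∑ j ∈ s, u j • c j := by
  classical
  induction s using Finset.induction_on generalizing c w with
  | empty =>
    refine ⟨0, fun _ => le_rfl, LinearMap.ext fun x => ?_⟩
    have hneg : w (-x) ≤ 0 := h (-x) (by simp)
    rw [map_neg] at hneg
    simpa using le_antisymm (h x (by simp)) (neg_nonpos.1 hneg)
  | insert a s ha ih =>
    have hupdate (u : ι → 𝕜) (t : 𝕜) :
        ∑ j ∈ insert a s, Function.update u a t j • c j = t • c a + ∑ j ∈ s, u j • c j := by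
      rw [Finset.sum_insert ha, Function.update_self]
      congr 1
      exact Finset.sum_congr rfl fun j hj => by
        rw [Function.update_of_ne (ne_of_mem_of_not_mem hj ha)]
    have hupdate_nonneg {u : ι → 𝕜} (hu : ∀ j, 0 ≤ u j) {t : 𝕜} (ht : 0 ≤ t) (j : ι) :
        0 ≤ Function.update u a t j :=
      (le_update_iff (x := (0 : ι → 𝕜))).2 ⟨ht, fun j _ => hu j⟩ j
    simp only [Finset.forall_mem_insert, and_imp] at h
    by_cases hs : ∀ x, (∀ j ∈ s, c j x ≤ 0) → w x ≤ 0
    · obtain ⟨u, hu, hw⟩ := ih c w hs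
      exact ⟨Function.update u a 0, hupdate_nonneg hu le_rfl, by
        rw [hupdate, zero_smul, zero_add, hw]⟩
    · obtain ⟨y, hay, hcy, hwy⟩ := exists_normalized_direction h hs
      -- Eliminate `c a` by projecting along `y` onto its kernel.
      let P : V →ₗ[𝕜] V := LinearMap.id - (c a).smulRight y
      obtain ⟨u, hu, hw⟩ := ih (fun j => c j ∘ₗ P) (w ∘ₗ P) fun x hx =>
        h (P x) (by simp [P, hay]) hx
      have huy : (∑ j ∈ s, u j • c j) y ≤ 0 := by
        rw [LinearMap.sum_apply]
        exact Finset.sum_nonpos fun j hj => smul_nonpos_of_nonneg_of_nonpos (hu j) (hcy j hj)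
      refine ⟨Function.update u a (w y - (∑ j ∈ s, u j • c j) y),
        hupdate_nonneg hu (sub_nonneg.2 (huy.trans hwy)), LinearMap.ext fun x => ?_⟩
      have hwP : w (P x) = (∑ j ∈ s, u j • c j) (P x) := by
        simpa [LinearMap.sum_apply] using LinearMap.congr_fun hw x
      simp only [P, LinearMap.sub_apply, LinearMap.id_apply, LinearMap.smulRight_apply, map_sub,
        map_smul, smul_eq_mul] at hwP
      rw [hupdate, LinearMap.add_apply, LinearMap.smul_apply, smul_eq_mul]
      linear_combination hwP

theorem nonpos_of_forall_le_of_recession {c : ι → Module.Dual 𝕜 V} {d : ι → 𝕜}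
    {w : Module.Dual 𝕜 V} {β : 𝕜} {x₀ : V} (hx₀ : ∀ j, c j x₀ ≤ d j)
    (h : ∀ x, (∀ j, c j x ≤ d j) → w x ≤ β) {x : V} (hx : ∀ j, c j x ≤ 0) : w x ≤ 0 := by
  refine slope_le_of_forall_add_mul_le (α := w x₀) (v := β) fun t ht => ?_
  have hray : w (x₀ + t • x) ≤ β := h _ fun j => by
    rw [map_add, map_smul]
    exact add_le_of_le_of_nonpos (hx₀ j) (smul_nonpos_of_nonneg_of_nonpos ht (hx j))
  simpa using hray

theorem exists_nonneg_eq_sum_smul_of_forall_le [Fintype ι] {c : ι → Module.Dual 𝕜 V} {d : ι → 𝕜}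
    {w : Module.Dual 𝕜 V} {β : 𝕜} {x₀ : V} (hx₀ : ∀ j, c j x₀ ≤ d j)
    (h : ∀ x, (∀ j, c j x ≤ d j) → w x ≤ β) :
    ∃ u : ι → 𝕜, (∀ j, 0 ≤ u j) ∧ w = ∑ j, u j • c j ∧ ∑ j, u j * d j ≤ β := by
  -- Homogenize: `none` stands for the constraint `0 ≤ t` on the homogenizing variable `t`.
  let c' : Option ι → Module.Dual 𝕜 (V × 𝕜) := fun o => o.elim (-LinearMap.snd 𝕜 V 𝕜)
    fun j => (c j).coprod (-(d j) • LinearMap.id)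
  obtain ⟨u, hu, hw⟩ := exists_nonneg_eq_sum_smul_of_forall_nonpos Finset.univ c'
    (w.coprod (-β • LinearMap.id)) (by
      rintro ⟨x, t⟩ hxt
      have ht : 0 ≤ t := by simpa [c'] using hxt none (Finset.mem_univ _)
      have hc : ∀ j, c j x ≤ t * d j := fun j => by
        simpa [c', mul_comm] using hxt (some j) (Finset.mem_univ _)
      suffices w x ≤ t * β by simpa [mul_comm] using this
      rcases ht.eq_or_lt with rfl | ht
      · rw [zero_mul]
        exact nonpos_of_forall_le_of_recession hx₀ h fun j => by simpa using hc j
      · have hscaled := h (t⁻¹ • x) fun j => by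
          rw [map_smul, smul_eq_mul, inv_mul_le_iff₀ ht]
          exact hc j
        rwa [map_smul, smul_eq_mul, inv_mul_le_iff₀ ht] at hscaled)
  refine ⟨fun j => u (some j), fun j => hu _, LinearMap.ext fun x => ?_, ?_⟩
  · simpa [c', Fintype.sum_option] using LinearMap.congr_fun hw (x, 0)
  · have hrhs := LinearMap.congr_fun hw (0, 1)
    simp only [c', Fintype.sum_option, LinearMap.coprod_apply, LinearMap.sum_apply,
      LinearMap.add_apply, LinearMap.smul_apply, LinearMap.neg_apply, LinearMap.snd_apply,
      LinearMap.id_apply, map_zero, Option.elim, smul_eq_mul, zero_add, mul_one, mul_neg,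
      Finset.sum_neg_distrib] at hrhs
    linarith [hu none]

end Farkas

section ConcaveDuality

variable {E ι : Type*} [NormedAddCommGroup E] [NormedSpace ℝ E] [FiniteDimensional ℝ E]
  {f : E → ℝ} {v : ℝ}

theorem exists_affine_between_of_concaveOn {s : Set E} (hf : ConcaveOn ℝ Set.univ f)
    (hs : Convex ℝ s) (hne : s.Nonempty) (h : ∀ x ∈ s, f x ≤ v) :
    ∃ (w : Module.Dual ℝ E) (q : ℝ), (∀ x, f x ≤ w x + q) ∧ ∀ x ∈ s, w x + q ≤ v := by
  have hopen : IsOpen {z : E × ℝ | z.2 < f z.1} :=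
    isOpen_lt continuous_snd (hf.locallyLipschitz.continuous.comp continuous_fst)
  have hdisj : Disjoint {z : E × ℝ | z.2 < f z.1} (s ×ˢ Set.Ici v) :=
    Set.disjoint_left.2 fun z hz hz' => (hz.trans_le (h z.1 hz'.1)).not_ge hz'.2
  obtain ⟨g, q, hhyp, hprod⟩ := geometric_hahn_banach_open
    (by simpa using hf.convex_strict_hypograph) hopen (hs.prod (convex_Ici v)) hdisj
  let w : Module.Dual ℝ E := (g : E × ℝ →ₗ[ℝ] ℝ) ∘ₗ LinearMap.inl ℝ E ℝ
  let τ : ℝ := g (0, 1)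
  have hg (x : E) (r : ℝ) : g (x, r) = w x + r * τ := by
    have hsplit : (x, r) = (x, (0 : ℝ)) + r • ((0 : E), (1 : ℝ)) := by simp
    rw [hsplit, map_add, map_smul]
    rfl
  simp only [Prod.forall, Set.mem_ofPred_eq, Set.mem_prod, Set.mem_Ici, and_imp, hg] at hhyp hprod
  obtain ⟨x₀, hx₀⟩ := hne
  have hτ : 0 < τ := by
    have hbelow := hhyp x₀ (f x₀ - 1) (by linarith)
    have habove := hprod x₀ v hx₀ le_rfl
    nlinarith [h x₀ hx₀]
  have hle (x : E) : w x + f x * τ ≤ q := by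
    refine le_of_forall_pos_lt_add fun δ hδ => ?_
    have hbelow := hhyp x (f x - δ / τ) (sub_lt_self _ (div_pos hδ hτ))
    rw [sub_mul, div_mul_cancel₀ _ hτ.ne'] at hbelow
    linarith
  refine ⟨-τ⁻¹ • w, τ⁻¹ * q, fun x => ?_, fun x hx => ?_⟩ <;>
    rw [LinearMap.smul_apply, smul_eq_mul, neg_mul, neg_add_eq_sub, ← mul_sub]
  · rw [le_inv_mul_iff₀ hτ]
    linarith [hle x]
  · rw [inv_mul_le_iff₀ hτ]
    linarith [hprod x v hx le_rfl]

theorem exists_lagrangeMultipliers_of_concaveOn [Fintype ι] (hf : ConcaveOn ℝ Set.univ f)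
    {c : ι → Module.Dual ℝ E} {d : ι → ℝ} {x₀ : E} (hx₀ : ∀ j, c j x₀ ≤ d j)
    (h : ∀ x, (∀ j, c j x ≤ d j) → f x ≤ v) :
    ∃ u : ι → ℝ, (∀ j, 0 ≤ u j) ∧ ∀ x, f x + ∑ j, u j * (d j - c j x) ≤ v := by
  have hconv : Convex ℝ {x | ∀ j, c j x ≤ d j} := by
    rw [Set.ofPred_forall]
    exact convex_iInter fun j => convex_halfSpace_le (c j).isLinear (d j)
  obtain ⟨w, q, hfw, hwv⟩ := exists_affine_between_of_concaveOn hf hconv ⟨x₀, hx₀⟩ h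
  obtain ⟨u, hu, rfl, hud⟩ := exists_nonneg_eq_sum_smul_of_forall_le hx₀
    fun x hx => le_sub_iff_add_le.2 (hwv x hx)
  refine ⟨u, hu, fun x => ?_⟩
  have hfx := hfw x
  simp only [LinearMap.sum_apply, LinearMap.smul_apply, smul_eq_mul] at hfx
  simp only [mul_sub, Finset.sum_sub_distrib]
  linarith

end ConcaveDuality

section RealFunctions

theorem exists_supergradient_of_mem_interior {f : ℝ → ℝ} {s : Set ℝ} (hf : ConcaveOn ℝ s f) {x : ℝ}
    (hx : x ∈ interior s) : ∃ lam, ∀ y ∈ s, f y ≤ f x + lam * (y - x) := by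
  refine ⟨-derivWithin (-f) (Set.Ioi x) x, fun y hy => ?_⟩
  rcases lt_trichotomy y x with hyx | rfl | hxy
  · have hslope := (hf.neg.slope_le_leftDeriv_of_mem_interior hy hx hyx).trans
      (hf.neg.leftDeriv_le_rightDeriv_of_mem_interior hx)
    rw [slope_def_field, div_le_iff₀ (sub_pos.2 hyx)] at hslope
    simp only [Pi.neg_apply] at hslope
    linarith
  · simp
  · have hslope := hf.neg.rightDeriv_le_slope_of_mem_interior hx hy hxy
    rw [slope_def_field, le_div_iff₀ (sub_pos.2 hxy)] at hslope
    simp only [Pi.neg_apply] at hslope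
    linarith

theorem exists_nonneg_supergradient_of_growth_le {f : ℝ → ℝ} (hf : ConcaveOn ℝ (Set.Ici 0) f)
    (hmono : MonotoneOn f (Set.Ici 0)) {L : ℝ} (hL : 0 ≤ L)
    (hgrowth : ∀ r, 0 ≤ r → f r ≤ f 0 + L * r) {ε : ℝ} (hε : 0 ≤ ε) :
    ∃ lam, 0 ≤ lam ∧ ∀ r, 0 ≤ r → f r ≤ f ε + lam * (r - ε) := by
  rcases hε.eq_or_lt with rfl | hpos
  · exact ⟨L, hL, fun r hr => by simpa using hgrowth r hr⟩
  · obtain ⟨lam, hlam⟩ := exists_supergradient_of_mem_interior hf (x := ε) (by simpa using hpos)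
    have hε1 : 0 ≤ ε + 1 := by positivity
    refine ⟨lam, ?_, hlam⟩
    linarith [hmono hε hε1 (by linarith), hlam (ε + 1) hε1]

open scoped Pointwise in
theorem isLUB_finsetSum {ι : Type*} (t : Finset ι) {S : ι → Set ℝ} {a : ι → ℝ}
    (h : ∀ i ∈ t, IsLUB (S i) (a i)) : IsLUB (∑ i ∈ t, S i) (∑ i ∈ t, a i) := by
  classical
  induction t using Finset.induction_on with
  | empty =>
    rw [Finset.sum_empty, Finset.sum_empty]
    exact isLUB_singleton
  | insert i t hi ih =>
    rw [Finset.forall_mem_insert] at h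
    rw [Finset.sum_insert hi, Finset.sum_insert hi]
    exact h.1.add (ih h.2)

theorem bddAbove_image_of_forall_sum_le {ι X : Type*} [Fintype ι] {Ξ : Set X} {φ : ι → X → ℝ}
    {x₀ : ι → X} (hx₀ : ∀ i, x₀ i ∈ Ξ) {B : ℝ}
    (h : ∀ y : ι → X, (∀ i, y i ∈ Ξ) → ∑ i, φ i (y i) ≤ B) (i : ι) : BddAbove (φ i '' Ξ) := by
  classical
  refine ⟨B - ∑ j ∈ Finset.univ.erase i, φ j (x₀ j), Set.forall_mem_image.2 fun x hx => ?_⟩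
  have hmem (j : ι) : Function.update x₀ i x j ∈ Ξ := by
    rcases eq_or_ne j i with rfl | hj
    · simpa using hx
    · simpa [hj] using hx₀ j
  have hsum := h _ hmem
  rw [← Finset.add_sum_erase _ _ (Finset.mem_univ i), Function.update_self,
    Finset.sum_congr rfl fun j hj => by
      rw [Function.update_of_ne (Finset.ne_of_mem_erase hj)]] at hsum
  linarith

open scoped Pointwise in
theorem exists_bounds_of_forall_sum_le {ι X : Type*} [Fintype ι] {Ξ : Set X} {φ : ι → X → ℝ}
    {x₀ : ι → X} (hx₀ : ∀ i, x₀ i ∈ Ξ) {B : ℝ}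
    (h : ∀ y : ι → X, (∀ i, y i ∈ Ξ) → ∑ i, φ i (y i) ≤ B) :
    ∃ s : ι → ℝ, (∀ i, ∀ x ∈ Ξ, φ i x ≤ s i) ∧ ∑ i, s i ≤ B := by
  have hlub (i : ι) : IsLUB (φ i '' Ξ) (sSup (φ i '' Ξ)) :=
    isLUB_csSup ⟨_, x₀ i, hx₀ i, rfl⟩ (bddAbove_image_of_forall_sum_le hx₀ h i)
  refine ⟨fun i => sSup (φ i '' Ξ), fun i x hx => (hlub i).1 ⟨x, hx, rfl⟩,
    (isLUB_finsetSum Finset.univ fun i _ => hlub i).2 fun z hz => ?_⟩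
  obtain ⟨g, hg, rfl⟩ := (Set.mem_fintype_sum _ _).1 hz
  choose y hy hyg using hg
  simpa only [hyg] using h y hy

end RealFunctions

section Seminorms

variable {E : Type*} [NormedAddCommGroup E] [NormedSpace ℝ E] [FiniteDimensional ℝ E]
  {q : Seminorm ℝ E}

theorem continuous_seminorm (q : Seminorm ℝ E) : Continuous q :=
  q.convexOn.locallyLipschitz.continuous

theorem exists_norm_le_mul_seminorm (hq : ∀ x, q x = 0 → x = 0) :
    ∃ c : ℝ, 0 < c ∧ ∀ x, ‖x‖ ≤ c * q x := by
  rcases subsingleton_or_nontrivial E with _ | _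
  · exact ⟨1, one_pos, fun x => by simp [Subsingleton.elim x 0]⟩
  obtain ⟨y, hy, hmin⟩ := (isCompact_sphere (0 : E) 1).exists_isMinOn
    (NormedSpace.sphere_nonempty.2 zero_le_one) (continuous_seminorm q).continuousOn
  have hqy : 0 < q y := (apply_nonneg q y).lt_of_ne' fun h => by simp [hq y h] at hy
  refine ⟨(q y)⁻¹, inv_pos.2 hqy, fun x => ?_⟩
  rcases eq_or_ne x 0 with rfl | hx
  · simp
  have hx' : 0 < ‖x‖ := norm_pos_iff.2 hx
  have hle : q y ≤ q (‖x‖⁻¹ • x) := hmin (by simp [norm_smul, hx'.ne'])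
  rw [map_smul_eq_mul, norm_inv, norm_norm, le_inv_mul_iff₀ hx'] at hle
  rwa [le_inv_mul_iff₀ hqy, mul_comm]

theorem exists_abs_le_mul_seminorm (hq : ∀ x, q x = 0 → x = 0) (f : Module.Dual ℝ E) :
    ∃ c : ℝ, 0 ≤ c ∧ ∀ x, |f x| ≤ c * q x := by
  obtain ⟨c, hc, hle⟩ := exists_norm_le_mul_seminorm hq
  refine ⟨‖f.toContinuousLinearMap‖ * c, by positivity, fun x => ?_⟩
  calc |f x| ≤ ‖f.toContinuousLinearMap‖ * ‖x‖ := f.toContinuousLinearMap.le_opNorm x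
    _ ≤ ‖f.toContinuousLinearMap‖ * (c * q x) := by gcongr; exact hle x
    _ = _ := (mul_assoc _ _ _).symm

theorem concaveOn_neg_mul_seminorm_sub {E : Type*} [AddCommGroup E] [Module ℝ E]
    (q : Seminorm ℝ E) {lam : ℝ} (hlam : 0 ≤ lam) (y : E) :
    ConcaveOn ℝ Set.univ fun x => -(lam * q (x - y)) := by
  have hconv : ConvexOn ℝ Set.univ fun x => lam * q (x - y) := by
    simpa only [Set.preimage_univ, Function.comp_def, smul_eq_mul, ← sub_eq_add_neg] using
      (q.convexOn.translate_left (-y)).smul hlam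
  exact hconv.neg

end Seminorms

section DualNorm

variable {m : ℕ} {nrm : Seminorm ℝ (Fin m → ℝ)}

theorem dualNorm_le_iff (hnrm : ∀ x, nrm x = 0 → x = 0) {z : Fin m → ℝ} {lam : ℝ} :
    dualNorm nrm z ≤ lam ↔ 0 ≤ lam ∧ ∀ x, z ⬝ᵥ x ≤ lam * nrm x := by
  obtain ⟨c, hc, hz⟩ := exists_abs_le_mul_seminorm hnrm (dotProductEquiv ℝ (Fin m) z)
  have hbdd : BddAbove ((fun x => z ⬝ᵥ x) '' {x | nrm x ≤ 1}) :=
    ⟨c, Set.forall_mem_image.2 fun x hx =>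
      (le_abs_self _).trans ((hz x).trans (mul_le_of_le_one_right hc hx))⟩
  constructor
  · intro h
    have hball (x : Fin m → ℝ) (hx : nrm x ≤ 1) : z ⬝ᵥ x ≤ lam :=
      (le_csSup hbdd ⟨x, hx, rfl⟩).trans h
    refine ⟨by simpa using hball 0 (by simp), fun x => ?_⟩
    rcases (apply_nonneg nrm x).eq_or_lt' with hx | hx
    · simp [hnrm x hx]
    · have hunit := hball ((nrm x)⁻¹ • x) (by
        rw [map_smul_eq_mul, norm_inv, Real.norm_of_nonneg hx.le, inv_mul_cancel₀ hx.ne'])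
      rwa [dotProduct_smul, smul_eq_mul, inv_mul_le_iff₀ hx, mul_comm] at hunit
  · rintro ⟨hlam, h⟩
    exact csSup_le ⟨_, 0, by simp, rfl⟩ (Set.forall_mem_image.2 fun x hx =>
      (h x).trans (mul_le_of_le_one_right hlam hx))

theorem dualNorm_le_iff_of_eq_sum_abs (hone : ∀ x, nrm x = ∑ l, |x l|) {z : Fin m → ℝ} {lam : ℝ} :
    dualNorm nrm z ≤ lam ↔ 0 ≤ lam ∧ ∀ l, |z l| ≤ lam := by
  have hdef (x : Fin m → ℝ) (hx : nrm x = 0) : x = 0 := by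
    rw [hone, Finset.sum_eq_zero_iff_of_nonneg fun _ _ => abs_nonneg _] at hx
    exact funext fun l => abs_eq_zero.1 (hx l (Finset.mem_univ l))
  rw [dualNorm_le_iff hdef]
  refine and_congr_right fun _ => ⟨fun h l => ?_, fun h x => ?_⟩
  · have hunit : nrm (Pi.single l 1) = 1 := by
      rw [hone, Finset.sum_eq_single l (fun j _ hj => by simp [hj]) (by simp)]
      simp
    have hpos := h (Pi.single l 1)
    have hneg := h (-Pi.single l 1)
    rw [map_neg_eq_map, hunit, dotProduct_neg, dotProduct_single_one, mul_one] at hneg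
    rw [hunit, dotProduct_single_one, mul_one] at hpos
    exact abs_le'.2 ⟨hpos, hneg⟩
  · rw [hone, Finset.mul_sum]
    refine Finset.sum_le_sum fun l _ => (le_abs_self _).trans ?_
    rw [abs_mul]
    exact mul_le_mul_of_nonneg_right (h l) (abs_nonneg _)

theorem dualNorm_le_iff_of_eq_iSup_abs (hsup : ∀ x, nrm x = ⨆ l, |x l|) {z : Fin m → ℝ}
    {lam : ℝ} : dualNorm nrm z ≤ lam ↔ ∑ l, |z l| ≤ lam := by
  have hle (x : Fin m → ℝ) (l : Fin m) : |x l| ≤ nrm x := by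
    rw [hsup]
    exact le_ciSup (f := fun l => |x l|) (Set.finite_range _).bddAbove l
  rw [dualNorm_le_iff fun x hx => funext fun l => abs_nonpos_iff.1 (hx ▸ hle x l)]
  constructor
  · rintro ⟨hlam, h⟩
    have hsign : nrm (fun l => SignType.sign (z l)) ≤ 1 := by
      rw [hsup]
      refine Real.iSup_le (fun l => ?_) zero_le_one
      rcases lt_trichotomy (z l) 0 with hl | hl | hl <;> simp [hl]
    simpa [dotProduct, self_mul_sign] using (h _).trans (mul_le_of_le_one_right hlam hsign)
  · intro h
    refine ⟨(Finset.sum_nonneg fun _ _ => abs_nonneg _).trans h, fun x => ?_⟩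
    refine le_trans ?_ (mul_le_mul_of_nonneg_right h (apply_nonneg nrm x))
    rw [Finset.sum_mul]
    refine Finset.sum_le_sum fun l _ => (le_abs_self _).trans ?_
    rw [abs_mul]
    exact mul_le_mul_of_nonneg_left (hle x l) (abs_nonneg _)

theorem forall_add_dotProduct_le_iff (hnrm : ∀ x, nrm x = 0 → x = 0) {z : Fin m → ℝ}
    {lam α v : ℝ} (hlam : 0 ≤ lam) :
    (∀ x, α + z ⬝ᵥ x ≤ v + lam * nrm x) ↔ α ≤ v ∧ dualNorm nrm z ≤ lam := by
  rw [dualNorm_le_iff hnrm]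
  constructor
  · refine fun h => ⟨by simpa using h 0, hlam, fun x =>
      slope_le_of_forall_add_mul_le (α := α) (v := v) fun t ht => ?_⟩
    have hray := h (t • x)
    rw [dotProduct_smul, smul_eq_mul, map_smul_eq_mul, Real.norm_of_nonneg ht] at hray
    linarith
  · rintro ⟨hα, -, h⟩ x
    exact add_le_add hα (h x)

end DualNorm

section Multipliers

variable {m p K : ℕ} {C : Matrix (Fin p) (Fin m) ℝ} {d : Fin p → ℝ}
  {A : Matrix (Fin K) (Fin m) ℝ} {b : Fin K → ℝ}

/-- The Lagrangian of the problem of maximizing `min_k (⟨a_k, x⟩ + b_k)` over the polyhedron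
`C x ≤ d`, written as the maximization of `t` subject to `t ≤ ⟨a_k, x⟩ + b_k` and `C x ≤ d`. The
multipliers `θ` sum to one, so that `t` no longer appears. -/
def lagrangian (C : Matrix (Fin p) (Fin m) ℝ) (d : Fin p → ℝ) (A : Matrix (Fin K) (Fin m) ℝ)
    (b : Fin K → ℝ) (γ : Fin p → ℝ) (θ : Fin K → ℝ) (x : Fin m → ℝ) : ℝ :=
  θ ⬝ᵥ (b + A *ᵥ x) + γ ⬝ᵥ (d - C *ᵥ x)

theorem lagrangian_sub (γ : Fin p → ℝ) (θ : Fin K → ℝ) (x u : Fin m → ℝ) :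
    lagrangian C d A b γ θ (x - u) = lagrangian C d A b γ θ x + (Cᵀ *ᵥ γ - Aᵀ *ᵥ θ) ⬝ᵥ u := by
  simp only [lagrangian, mulVec_sub, dotProduct_add, dotProduct_sub, sub_dotProduct,
    mulVec_transpose, ← dotProduct_mulVec]
  ring

theorem lagrangian_le_iff {nrm : Seminorm ℝ (Fin m → ℝ)} (hnrm : ∀ x, nrm x = 0 → x = 0)
    {γ : Fin p → ℝ} {θ : Fin K → ℝ} {y : Fin m → ℝ} {lam v : ℝ} (hlam : 0 ≤ lam) :
    (∀ x, lagrangian C d A b γ θ x ≤ v + lam * nrm (x - y)) ↔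
      lagrangian C d A b γ θ y ≤ v ∧ dualNorm nrm (Cᵀ *ᵥ γ - Aᵀ *ᵥ θ) ≤ lam := by
  rw [← forall_add_dotProduct_le_iff hnrm hlam, ← (Equiv.subLeft y).forall_congr_right]
  simp only [Equiv.subLeft_apply, lagrangian_sub, sub_sub_cancel_left, map_neg_eq_map]

theorem minAffine_le (k : Fin K) (x : Fin m → ℝ) : minAffine A b x ≤ A k ⬝ᵥ x + b k :=
  ciInf_le (f := fun k => A k ⬝ᵥ x + b k) (Set.finite_range _).bddBelow k

theorem le_minAffine_iff [NeZero K] {x : Fin m → ℝ} {v : ℝ} :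
    v ≤ minAffine A b x ↔ ∀ k, v ≤ A k ⬝ᵥ x + b k :=
  le_ciInf_iff (f := fun k => A k ⬝ᵥ x + b k) (Set.finite_range _).bddBelow

theorem le_maxAffine (k : Fin K) (x : Fin m → ℝ) : A k ⬝ᵥ x + b k ≤ maxAffine A b x :=
  le_ciSup (f := fun k => A k ⬝ᵥ x + b k) (Set.finite_range _).bddAbove k

theorem maxAffine_le_iff [NeZero K] {x : Fin m → ℝ} {v : ℝ} :
    maxAffine A b x ≤ v ↔ ∀ k, A k ⬝ᵥ x + b k ≤ v :=
  ciSup_le_iff (f := fun k => A k ⬝ᵥ x + b k) (Set.finite_range _).bddAbove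

theorem minAffine_le_lagrangian {γ : Fin p → ℝ} {θ : Fin K → ℝ} (hγ : 0 ≤ γ) (hθ : 0 ≤ θ)
    (hθ1 : θ ⬝ᵥ 1 = 1) {x : Fin m → ℝ} (hx : x ∈ polytope C d) :
    minAffine A b x ≤ lagrangian C d A b γ θ x := by
  have hslack : 0 ≤ γ ⬝ᵥ (d - C *ᵥ x) := dotProduct_nonneg_of_nonneg hγ (sub_nonneg.2 hx)
  calc minAffine A b x = ∑ k, θ k * minAffine A b x := by
        rw [← Finset.sum_mul, ← dotProduct_one, hθ1, one_mul]
    _ ≤ θ ⬝ᵥ (b + A *ᵥ x) := Finset.sum_le_sum fun k _ =>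
        mul_le_mul_of_nonneg_left ((minAffine_le k x).trans_eq (add_comm _ _)) (hθ k)
    _ ≤ lagrangian C d A b γ θ x := le_add_of_nonneg_right hslack

theorem exists_multipliers_hypograph [NeZero K] {g : (Fin m → ℝ) → ℝ}
    (hg : ConcaveOn ℝ Set.univ g) {y : Fin m → ℝ} (hy : y ∈ polytope C d) {v : ℝ}
    (h : ∀ x ∈ polytope C d, minAffine A b x + g x ≤ v) :
    ∃ (γ : Fin p → ℝ) (θ : Fin K → ℝ), 0 ≤ γ ∧ 0 ≤ θ ∧ ∀ x (t : ℝ),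
      t + g x + (γ ⬝ᵥ (d - C *ᵥ x) + θ ⬝ᵥ (b + A *ᵥ x - t • 1)) ≤ v := by
  have hconc : ConcaveOn ℝ Set.univ fun z : (Fin m → ℝ) × ℝ => z.2 + g z.1 :=
    ((LinearMap.snd ℝ (Fin m → ℝ) ℝ).concaveOn convex_univ).add
      (hg.comp_linearMap (LinearMap.fst ℝ (Fin m → ℝ) ℝ))
  let c : Fin p ⊕ Fin K → Module.Dual ℝ ((Fin m → ℝ) × ℝ) := Sum.elim
    (fun j => LinearMap.proj j ∘ₗ C.mulVecLin ∘ₗ LinearMap.fst ℝ _ _)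
    fun k => LinearMap.snd ℝ _ _ - LinearMap.proj k ∘ₗ A.mulVecLin ∘ₗ LinearMap.fst ℝ _ _
  have hfeas (x : Fin m → ℝ) (t : ℝ) :
      (∀ r, c r (x, t) ≤ Sum.elim d b r) ↔ x ∈ polytope C d ∧ t ≤ minAffine A b x := by
    rw [Sum.forall, le_minAffine_iff]
    exact and_congr Iff.rfl (forall_congr' fun k => sub_le_iff_le_add')
  obtain ⟨u, hu, hle⟩ := exists_lagrangeMultipliers_of_concaveOn hconc
    ((hfeas y _).2 ⟨hy, le_rfl⟩) (v := v) (by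
      rintro ⟨x, t⟩ hxt
      obtain ⟨hx, ht⟩ := (hfeas x t).1 hxt
      exact (add_le_add_left ht (g x)).trans (h x hx))
  refine ⟨fun j => u (.inl j), fun k => u (.inr k), fun j => hu _, fun k => hu _, fun x t => ?_⟩
  have hslack (k : Fin K) : b k - c (.inr k) (x, t) = (b + A *ᵥ x - t • (1 : Fin K → ℝ)) k := by
    change b k - (t - (A *ᵥ x) k) = b k + (A *ᵥ x) k - t * 1
    ring
  have hsum := hle (x, t)
  simp only [Fintype.sum_sum_type, Sum.elim_inl, Sum.elim_inr, hslack] at hsum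
  exact hsum

theorem exists_lagrangian_add_le [NeZero K] {g : (Fin m → ℝ) → ℝ} (hg : ConcaveOn ℝ Set.univ g)
    {y : Fin m → ℝ} (hy : y ∈ polytope C d) {v : ℝ}
    (h : ∀ x ∈ polytope C d, minAffine A b x + g x ≤ v) :
    ∃ (γ : Fin p → ℝ) (θ : Fin K → ℝ), 0 ≤ γ ∧ 0 ≤ θ ∧ θ ⬝ᵥ 1 = 1 ∧
      ∀ x, lagrangian C d A b γ θ x + g x ≤ v := by
  obtain ⟨γ, θ, hγ, hθ, hle⟩ := exists_multipliers_hypograph hg hy h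
  have hle' (x : Fin m → ℝ) (t : ℝ) :
      lagrangian C d A b γ θ x + g x + t * 1 ≤ v + t * (θ ⬝ᵥ 1) := by
    have hxt := hle x t
    rw [dotProduct_sub θ, dotProduct_smul, smul_eq_mul] at hxt
    unfold lagrangian
    linarith
  have hθ1 : θ ⬝ᵥ 1 = 1 := le_antisymm
    (slope_le_of_forall_add_mul_le (α := lagrangian C d A b γ θ y + g y) (v := v)
      fun t _ => by linarith [hle' y (-t)])
    (slope_le_of_forall_add_mul_le fun t _ => hle' y t)
  exact ⟨γ, θ, hγ, hθ, hθ1, fun x => by simpa using hle' x 0⟩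

theorem exists_multipliers_minAffine_iff [NeZero K] {nrm : Seminorm ℝ (Fin m → ℝ)}
    (hnrm : ∀ x, nrm x = 0 → x = 0) {y : Fin m → ℝ} (hy : y ∈ polytope C d) {lam v : ℝ} :
    (∃ (γ : Fin p → ℝ) (θ : Fin K → ℝ), lagrangian C d A b γ θ y ≤ v ∧
      dualNorm nrm (Cᵀ *ᵥ γ - Aᵀ *ᵥ θ) ≤ lam ∧ θ ⬝ᵥ 1 = 1 ∧ 0 ≤ γ ∧ 0 ≤ θ) ↔
    0 ≤ lam ∧ ∀ x ∈ polytope C d, minAffine A b x ≤ v + lam * nrm (x - y) := by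
  constructor
  · rintro ⟨γ, θ, hv, hdual, hθ1, hγ, hθ⟩
    have hlam : 0 ≤ lam := ((dualNorm_le_iff hnrm).1 hdual).1
    exact ⟨hlam, fun x hx => (minAffine_le_lagrangian hγ hθ hθ1 hx).trans
      ((lagrangian_le_iff hnrm hlam).2 ⟨hv, hdual⟩ x)⟩
  · rintro ⟨hlam, h⟩
    obtain ⟨γ, θ, hγ, hθ, hθ1, hle⟩ := exists_lagrangian_add_le
      (concaveOn_neg_mul_seminorm_sub nrm hlam y) hy (A := A) (b := b) (v := v)
      fun x hx => by linarith [h x hx]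
    obtain ⟨hv, hdual⟩ := (lagrangian_le_iff hnrm hlam (v := v) (y := y)).1
      fun x => by linarith [hle x]
    exact ⟨γ, θ, hv, hdual, hθ1, hγ, hθ⟩

theorem exists_multipliers_affine_iff {nrm : Seminorm ℝ (Fin m → ℝ)}
    (hnrm : ∀ x, nrm x = 0 → x = 0) {a : Fin m → ℝ} {β : ℝ} {y : Fin m → ℝ}
    (hy : y ∈ polytope C d) {lam v : ℝ} :
    (∃ γ : Fin p → ℝ, β + a ⬝ᵥ y + γ ⬝ᵥ (d - C *ᵥ y) ≤ v ∧
      dualNorm nrm (Cᵀ *ᵥ γ - a) ≤ lam ∧ 0 ≤ γ) ↔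
    0 ≤ lam ∧ ∀ x ∈ polytope C d, a ⬝ᵥ x + β ≤ v + lam * nrm (x - y) := by
  let A₁ : Matrix (Fin 1) (Fin m) ℝ := of fun _ => a
  have hone (θ : Fin 1 → ℝ) : θ ⬝ᵥ 1 = 1 ↔ θ = 1 := by
    rw [dotProduct_one, Fin.sum_univ_one, funext_iff, Fin.forall_fin_one, Pi.one_apply]
  have hmin (x : Fin m → ℝ) : minAffine A₁ (fun _ => β) x = a ⬝ᵥ x + β := ciInf_unique
  have htranspose : A₁ᵀ *ᵥ 1 = a := by
    ext l
    simp [A₁, mulVec, dotProduct]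
  have hvalue (γ : Fin p → ℝ) : lagrangian C d A₁ (fun _ => β) γ 1 y =
      β + a ⬝ᵥ y + γ ⬝ᵥ (d - C *ᵥ y) := by
    simp [lagrangian, A₁, dotProduct, mulVec]
  have hmain := exists_multipliers_minAffine_iff (A := A₁) (b := fun _ => β) hnrm hy
    (lam := lam) (v := v)
  simp only [hmin, hone] at hmain
  rw [← hmain]
  refine exists_congr fun γ => ⟨fun ⟨hv, hdual, hγ⟩ => ?_, ?_⟩
  · exact ⟨1, (hvalue γ).trans_le hv, htranspose ▸ hdual, rfl, hγ, zero_le_one⟩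
  · rintro ⟨_, hv, hdual, rfl, hγ, -⟩
    exact ⟨(hvalue γ).symm.trans_le hv, htranspose ▸ hdual, hγ⟩

end Multipliers

section LipschitzFunctions

variable {E : Type*} [NormedAddCommGroup E] [NormedSpace ℝ E] [FiniteDimensional ℝ E]
  {q : Seminorm ℝ E} {L : ℝ} {ℓ : E → ℝ}

/-- Lipschitz continuity of a real function with respect to a seminorm that need not be the norm
of the space. The one-sided bound suffices, since `x` and `y` may be exchanged. -/
def IsLipschitzFor {E : Type*} [AddCommGroup E] [Module ℝ E] (q : Seminorm ℝ E) (L : ℝ)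
    (ℓ : E → ℝ) : Prop :=
  ∀ x y, ℓ x ≤ ℓ y + L * q (x - y)

theorem IsLipschitzFor.abs_sub_le {E : Type*} [AddCommGroup E] [Module ℝ E] {q : Seminorm ℝ E}
    {ℓ : E → ℝ} (hℓ : IsLipschitzFor q L ℓ) (x y : E) : |ℓ x - ℓ y| ≤ L * q (x - y) := by
  have hyx := hℓ y x
  rw [map_sub_rev] at hyx
  exact abs_le'.2 ⟨by linarith [hℓ x y], by linarith⟩

theorem IsLipschitzFor.continuous (hℓ : IsLipschitzFor q L ℓ) : Continuous ℓ := by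
  refine continuous_iff_continuousAt.2 fun y => tendsto_iff_norm_sub_tendsto_zero.2 ?_
  have hq : Continuous fun x => L * q (x - y) :=
    continuous_const.mul ((continuous_seminorm q).comp (continuous_sub_right y))
  exact squeeze_zero (fun _ => norm_nonneg _) (fun x => hℓ.abs_sub_le x y)
    (by simpa using hq.tendsto y)

theorem IsLipschitzFor.integrable [MeasurableSpace E] [BorelSpace E] {μ : Measure E}
    [IsFiniteMeasure μ] (hℓ : IsLipschitzFor q L ℓ) (hq : Integrable q μ) : Integrable ℓ μ := by
  refine ((integrable_const |ℓ 0|).add (hq.const_mul L)).mono'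
    hℓ.continuous.aestronglyMeasurable (Filter.Eventually.of_forall fun x => ?_)
  calc |ℓ x| = |ℓ 0 + (ℓ x - ℓ 0)| := by rw [add_sub_cancel]
    _ ≤ |ℓ 0| + |ℓ x - ℓ 0| := abs_add_le _ _
    _ ≤ |ℓ 0| + L * q x := by simpa using hℓ.abs_sub_le x 0

end LipschitzFunctions

section Transport

theorem integral_map_snd_le_integral_map_fst_add {X Y : Type*} [MeasurableSpace X]
    [MeasurableSpace Y] {π : Measure (X × Y)} {φ : X → ℝ} {ψ : Y → ℝ} {c : X × Y → ℝ} {lam : ℝ}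
    (hφ : Integrable φ (π.map Prod.fst)) (hψ : Integrable ψ (π.map Prod.snd))
    (hc : Integrable c π) (h : ∀ᵐ z ∂π, ψ z.2 ≤ φ z.1 + lam * c z) :
    ∫ y, ψ y ∂(π.map Prod.snd) ≤ ∫ x, φ x ∂(π.map Prod.fst) + lam * ∫ z, c z ∂π := by
  rw [integral_map measurable_snd.aemeasurable hψ.aestronglyMeasurable,
    integral_map measurable_fst.aemeasurable hφ.aestronglyMeasurable, ← integral_const_mul,
    ← integral_add (f := fun z => φ z.1) (hφ.comp_measurable measurable_fst) (hc.const_mul lam)]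
  exact integral_mono_ae (hψ.comp_measurable measurable_snd)
    ((hφ.comp_measurable measurable_fst).add (hc.const_mul lam)) h

variable {m : ℕ} {nrm : Seminorm ℝ (Fin m → ℝ)} {Ξ : Set (Fin m → ℝ)}

theorem wassersteinDist_le_ofReal_iff {Q₁ Q₂ : Measure (Fin m → ℝ)} {r : ℝ} (hr : 0 ≤ r) :
    wassersteinDist nrm Q₁ Q₂ ≤ ENNReal.ofReal r ↔
      ∀ δ : ℝ, 0 < δ → ∃ π : Measure ((Fin m → ℝ) × (Fin m → ℝ)),
        (π.map Prod.fst = Q₁ ∧ π.map Prod.snd = Q₂) ∧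
        ∫⁻ z, ENNReal.ofReal (nrm (z.1 - z.2)) ∂π ≤ ENNReal.ofReal (r + δ) := by
  constructor
  · intro h δ hδ
    have hlt : wassersteinDist nrm Q₁ Q₂ < ENNReal.ofReal (r + δ) :=
      h.trans_lt ((ENNReal.ofReal_lt_ofReal_iff (by linarith)).2 (by linarith))
    simp only [wassersteinDist, iInf_lt_iff] at hlt
    obtain ⟨π, hπ, hlt⟩ := hlt
    exact ⟨π, hπ, hlt.le⟩
  · intro h
    refine ENNReal.le_of_forall_pos_le_add fun δ hδ _ => ?_
    obtain ⟨π, hπ, hle⟩ := h δ hδ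
    rw [ENNReal.ofReal_add hr δ.coe_nonneg, ENNReal.ofReal_coe_nnreal] at hle
    exact (iInf₂_le π hπ).trans hle

theorem integrable_and_integral_le_of_lintegral_ofReal_le {X : Type*} [MeasurableSpace X]
    {μ : Measure X} {f : X → ℝ} (hmeas : AEStronglyMeasurable f μ) (hf : ∀ x, 0 ≤ f x) {r : ℝ}
    (hr : 0 ≤ r) (h : ∫⁻ x, ENNReal.ofReal (f x) ∂μ ≤ ENNReal.ofReal r) :
    Integrable f μ ∧ ∫ x, f x ∂μ ≤ r := by
  have hae : 0 ≤ᵐ[μ] f := Filter.Eventually.of_forall hf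
  refine ⟨⟨hmeas, ?_⟩, ?_⟩
  · rw [hasFiniteIntegral_iff_ofReal hae]
    exact h.trans_lt ENNReal.ofReal_lt_top
  · rw [integral_eq_lintegral_of_nonneg_ae hae hmeas]
    exact ENNReal.toReal_le_of_le_ofReal hr h

theorem exists_coupling_integral_le {Q₁ Q₂ : Measure (Fin m → ℝ)} {r δ : ℝ} (hr : 0 ≤ r)
    (h : wassersteinDist nrm Q₁ Q₂ ≤ ENNReal.ofReal r) (hδ : 0 < δ) :
    ∃ π : Measure ((Fin m → ℝ) × (Fin m → ℝ)), π.map Prod.fst = Q₁ ∧ π.map Prod.snd = Q₂ ∧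
      Integrable (fun z => nrm (z.1 - z.2)) π ∧ ∫ z, nrm (z.1 - z.2) ∂π ≤ r + δ := by
  obtain ⟨π, ⟨hfst, hsnd⟩, hle⟩ := (wassersteinDist_le_ofReal_iff hr).1 h δ hδ
  exact ⟨π, hfst, hsnd, integrable_and_integral_le_of_lintegral_ofReal_le
    ((continuous_seminorm nrm).comp (continuous_fst.sub continuous_snd)).aestronglyMeasurable
    (fun _ => apply_nonneg nrm _) (by positivity) hle⟩

theorem integrable_seminorm_of_mem_firstMomentMeasures {Q : Measure (Fin m → ℝ)}
    (hQ : Q ∈ firstMomentMeasures nrm Ξ) : Integrable nrm Q :=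
  ⟨(continuous_seminorm nrm).aestronglyMeasurable,
    (hasFiniteIntegral_iff_ofReal
      (Filter.Eventually.of_forall fun _ => apply_nonneg nrm _)).2 hQ.2.2⟩

theorem IsLipschitzFor.integrable_of_mem_firstMomentMeasures {ℓ : (Fin m → ℝ) → ℝ} {L : ℝ}
    (hℓ : IsLipschitzFor nrm L ℓ) {Q : Measure (Fin m → ℝ)}
    (hQ : Q ∈ firstMomentMeasures nrm Ξ) : Integrable ℓ Q :=
  have := hQ.1
  hℓ.integrable (integrable_seminorm_of_mem_firstMomentMeasures hQ)

end Transport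

section Mixtures

variable {m : ℕ} {nrm : Seminorm ℝ (Fin m → ℝ)} {Ξ : Set (Fin m → ℝ)}
  {P₁ P₂ Q₁ Q₂ : Measure (Fin m → ℝ)} {a b r₁ r₂ : ℝ}

/-- The mixture `a μ + b ν` of two measures, for nonnegative weights `a` and `b`. -/
noncomputable def mixture {X : Type*} [MeasurableSpace X] (a b : ℝ) (μ ν : Measure X) : Measure X :=
  ENNReal.ofReal a • μ + ENNReal.ofReal b • ν

theorem ofReal_add_ofReal_eq_one (ha : 0 ≤ a) (hb : 0 ≤ b) (hab : a + b = 1) :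
    ENNReal.ofReal a + ENNReal.ofReal b = 1 := by
  rw [← ENNReal.ofReal_add ha hb, hab, ENNReal.ofReal_one]

theorem mixture_self {X : Type*} [MeasurableSpace X] (ha : 0 ≤ a) (hb : 0 ≤ b) (hab : a + b = 1)
    (μ : Measure X) : mixture a b μ μ = μ := by
  rw [mixture, ← add_smul, ofReal_add_ofReal_eq_one ha hb hab, one_smul]

theorem map_mixture {X Y : Type*} [MeasurableSpace X] [MeasurableSpace Y] {f : X → Y}
    (hf : Measurable f) (a b : ℝ) (μ ν : Measure X) :
    (mixture a b μ ν).map f = mixture a b (μ.map f) (ν.map f) := by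
  simp only [mixture, Measure.map_add _ _ hf, Measure.map_smul]

theorem integral_mixture {X : Type*} [MeasurableSpace X] {μ ν : Measure X} {f : X → ℝ}
    (ha : 0 ≤ a) (hb : 0 ≤ b) (hμ : Integrable f μ) (hν : Integrable f ν) :
    ∫ x, f x ∂(mixture a b μ ν) = a * ∫ x, f x ∂μ + b * ∫ x, f x ∂ν := by
  rw [mixture, integral_add_measure (hμ.smul_measure ENNReal.ofReal_ne_top)
    (hν.smul_measure ENNReal.ofReal_ne_top), integral_smul_measure, integral_smul_measure,
    ENNReal.toReal_ofReal ha, ENNReal.toReal_ofReal hb, smul_eq_mul, smul_eq_mul]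

theorem mixture_mem_firstMomentMeasures (ha : 0 ≤ a) (hb : 0 ≤ b) (hab : a + b = 1)
    (hQ₁ : Q₁ ∈ firstMomentMeasures nrm Ξ) (hQ₂ : Q₂ ∈ firstMomentMeasures nrm Ξ) :
    mixture a b Q₁ Q₂ ∈ firstMomentMeasures nrm Ξ := by
  obtain ⟨_, hsupp₁, hfin₁⟩ := hQ₁
  obtain ⟨_, hsupp₂, hfin₂⟩ := hQ₂
  refine ⟨⟨?_⟩, by simp [mixture, hsupp₁, hsupp₂], ?_⟩
  · simp [mixture, ofReal_add_ofReal_eq_one ha hb hab]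
  · rw [mixture, lintegral_add_measure, lintegral_smul_measure, lintegral_smul_measure]
    exact ENNReal.add_lt_top.2 ⟨ENNReal.mul_lt_top ENNReal.ofReal_lt_top hfin₁,
      ENNReal.mul_lt_top ENNReal.ofReal_lt_top hfin₂⟩

theorem wassersteinDist_mixture_le (ha : 0 ≤ a) (hb : 0 ≤ b) (hab : a + b = 1) (hr₁ : 0 ≤ r₁)
    (hr₂ : 0 ≤ r₂) (h₁ : wassersteinDist nrm P₁ Q₁ ≤ ENNReal.ofReal r₁)
    (h₂ : wassersteinDist nrm P₂ Q₂ ≤ ENNReal.ofReal r₂) :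
    wassersteinDist nrm (mixture a b P₁ P₂) (mixture a b Q₁ Q₂) ≤
      ENNReal.ofReal (a * r₁ + b * r₂) := by
  rw [wassersteinDist_le_ofReal_iff (by positivity)]
  intro δ hδ
  obtain ⟨π₁, ⟨rfl, rfl⟩, hcost₁⟩ := (wassersteinDist_le_ofReal_iff hr₁).1 h₁ δ hδ
  obtain ⟨π₂, ⟨rfl, rfl⟩, hcost₂⟩ := (wassersteinDist_le_ofReal_iff hr₂).1 h₂ δ hδ
  refine ⟨mixture a b π₁ π₂,
    ⟨map_mixture measurable_fst _ _ _ _, map_mixture measurable_snd _ _ _ _⟩, ?_⟩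
  have hsplit : a * r₁ + b * r₂ + δ = a * (r₁ + δ) + b * (r₂ + δ) := by
    linear_combination -δ * hab
  rw [mixture, lintegral_add_measure, lintegral_smul_measure, lintegral_smul_measure, hsplit,
    ENNReal.ofReal_add (by positivity) (by positivity), ENNReal.ofReal_mul ha,
    ENNReal.ofReal_mul hb]
  exact add_le_add (mul_le_mul_right hcost₁ _) (mul_le_mul_right hcost₂ _)

theorem mixture_mem_wassersteinBall {N : ℕ} {ξ : Fin N → Fin m → ℝ} (ha : 0 ≤ a) (hb : 0 ≤ b)
    (hab : a + b = 1) (hr₁ : 0 ≤ r₁) (hr₂ : 0 ≤ r₂) (hQ₁ : Q₁ ∈ wassersteinBall nrm Ξ ξ r₁)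
    (hQ₂ : Q₂ ∈ wassersteinBall nrm Ξ ξ r₂) :
    mixture a b Q₁ Q₂ ∈ wassersteinBall nrm Ξ ξ (a * r₁ + b * r₂) := by
  refine ⟨mixture_mem_firstMomentMeasures ha hb hab hQ₁.1 hQ₂.1, ?_⟩
  simpa only [mixture_self ha hb hab] using
    wassersteinDist_mixture_le ha hb hab hr₁ hr₂ hQ₁.2 hQ₂.2

end Mixtures

section EmpiricalMeasures

variable {m N : ℕ} {nrm : Seminorm ℝ (Fin m → ℝ)} {Ξ : Set (Fin m → ℝ)}

theorem empirical_compl_eq_zero {ξ : Fin N → Fin m → ℝ} (hξ : ∀ i, ξ i ∈ Ξ) :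
    empirical ξ Ξᶜ = 0 := by
  simp [empirical, hξ]

theorem integrable_empirical [NeZero N] (ξ : Fin N → Fin m → ℝ) (g : (Fin m → ℝ) → ℝ) :
    Integrable g (empirical ξ) :=
  (integrable_finsetSum_measure.2 fun _ _ => integrable_dirac (by simp)).smul_measure
    (by simp [NeZero.ne N])

theorem integral_empirical (ξ : Fin N → Fin m → ℝ) (g : (Fin m → ℝ) → ℝ) :
    ∫ x, g x ∂(empirical ξ) = (1 / (N : ℝ)) * ∑ i, g (ξ i) := by
  rw [empirical, integral_smul_measure,
    integral_finsetSum_measure fun i _ => integrable_dirac (by simp)]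
  simp

theorem lintegral_empirical (ξ : Fin N → Fin m → ℝ) (g : (Fin m → ℝ) → ℝ≥0∞) :
    ∫⁻ x, g x ∂(empirical ξ) = (N : ℝ≥0∞)⁻¹ * ∑ i, g (ξ i) := by
  rw [empirical, lintegral_smul_measure, lintegral_finsetSum_measure]
  simp

theorem empirical_mem_firstMomentMeasures [NeZero N] {ξ : Fin N → Fin m → ℝ}
    (hξ : ∀ i, ξ i ∈ Ξ) : empirical ξ ∈ firstMomentMeasures nrm Ξ := by
  refine ⟨⟨?_⟩, empirical_compl_eq_zero hξ, ?_⟩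
  · simp [empirical, ENNReal.inv_mul_cancel (NeZero.ne (N : ℝ≥0∞)) (ENNReal.natCast_ne_top N)]
  · rw [lintegral_empirical]
    exact ENNReal.mul_lt_top (by simp [NeZero.pos N])
      (ENNReal.sum_lt_top.2 fun i _ => ENNReal.ofReal_lt_top)

theorem wassersteinDist_empirical_le [NeZero N] (ξ y : Fin N → Fin m → ℝ) :
    wassersteinDist nrm (empirical ξ) (empirical y) ≤
      ENNReal.ofReal ((1 / (N : ℝ)) * ∑ i, nrm (y i - ξ i)) := by
  have hmap {f : (Fin m → ℝ) × (Fin m → ℝ) → Fin m → ℝ} (hf : Measurable f) :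
      ((N : ℝ≥0∞)⁻¹ • ∑ i, Measure.dirac (ξ i, y i)).map f =
        empirical fun i => f (ξ i, y i) := by
    rw [Measure.map_smul, Measure.map_finset_sum hf.aemeasurable]
    simp only [Measure.map_dirac' hf, empirical]
  refine (iInf₂_le _ ⟨hmap measurable_fst, hmap measurable_snd⟩).trans ?_
  rw [lintegral_smul_measure, lintegral_finsetSum_measure, ENNReal.ofReal_mul (by positivity),
    ENNReal.ofReal_sum_of_nonneg fun i _ => apply_nonneg nrm _, one_div,
    ENNReal.ofReal_inv_of_pos (Nat.cast_pos.2 (NeZero.pos N)), ENNReal.ofReal_natCast]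
  simp [map_sub_rev]

theorem empirical_mem_wassersteinBall [NeZero N] (ξ : Fin N → Fin m → ℝ) {y : Fin N → Fin m → ℝ}
    (hy : ∀ i, y i ∈ Ξ) :
    empirical y ∈ wassersteinBall nrm Ξ ξ ((1 / (N : ℝ)) * ∑ i, nrm (y i - ξ i)) :=
  ⟨empirical_mem_firstMomentMeasures hy, wassersteinDist_empirical_le ξ y⟩

theorem wassersteinBall_mono {ξ : Fin N → Fin m → ℝ} {r r' : ℝ} (h : r ≤ r') :
    wassersteinBall nrm Ξ ξ r ⊆ wassersteinBall nrm Ξ ξ r' :=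
  fun _ hQ => ⟨hQ.1, hQ.2.trans (ENNReal.ofReal_le_ofReal h)⟩

theorem empirical_self_mem_wassersteinBall [NeZero N] {ξ : Fin N → Fin m → ℝ}
    (hξ : ∀ i, ξ i ∈ Ξ) {r : ℝ} (hr : 0 ≤ r) : empirical ξ ∈ wassersteinBall nrm Ξ ξ r :=
  wassersteinBall_mono (by simpa using hr) (empirical_mem_wassersteinBall ξ hξ)

end EmpiricalMeasures

section WorstCaseDuality

variable {m N : ℕ} {nrm : Seminorm ℝ (Fin m → ℝ)} {Ξ : Set (Fin m → ℝ)}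
  {ξ : Fin N → Fin m → ℝ} {ℓ : (Fin m → ℝ) → ℝ} {L : ℝ}

/-- The feasible pairs `(λ, s)` of the semi-infinite dual of the worst-case expectation problem:
the dual prices `λ` of the transport budget and `sᵢ` of the mass at the atom `ξᵢ`. -/
def dualFeasible (nrm : Seminorm ℝ (Fin m → ℝ)) (Ξ : Set (Fin m → ℝ)) (ξ : Fin N → Fin m → ℝ)
    (ℓ : (Fin m → ℝ) → ℝ) : Set (ℝ × (Fin N → ℝ)) :=
  {(lam, s) | 0 ≤ lam ∧ ∀ i, ∀ x ∈ Ξ, ℓ x ≤ s i + lam * nrm (x - ξ i)}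

/-- The real worst-case expectation of `ℓ` as a function of the radius of the Wasserstein ball. It
is meaningful only where the supremum is finite, as it is for Lipschitz losses and nonnegative
radii. -/
noncomputable def worstCaseReal (nrm : Seminorm ℝ (Fin m → ℝ)) (Ξ : Set (Fin m → ℝ))
    (ξ : Fin N → Fin m → ℝ) (ℓ : (Fin m → ℝ) → ℝ) (r : ℝ) : ℝ :=
  sSup ((fun Q => ∫ x, ℓ x ∂Q) '' wassersteinBall nrm Ξ ξ r)

theorem exists_fiberwise_min {ι X α : Type*} [Finite ι] [ConditionallyCompleteLinearOrder α]
    (f : ι → X) (s : ι → α) :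
    ∃ g : X → α, (∀ i, g (f i) ≤ s i) ∧ ∀ i, ∃ j, f j = f i ∧ s j = g (f i) :=
  ⟨fun x => sInf (s '' {i | f i = x}), fun i => csInf_le (Set.toFinite _).bddBelow ⟨i, rfl, rfl⟩,
    fun i => Set.Nonempty.csInf_mem (s := s '' {j | f j = f i}) ⟨s i, i, rfl, rfl⟩
      (Set.toFinite _)⟩

theorem exists_potential_of_mem_dualFeasible {lam : ℝ} {s : Fin N → ℝ}
    (h : (lam, s) ∈ dualFeasible nrm Ξ ξ ℓ) :
    ∃ g : (Fin m → ℝ) → ℝ, (∀ i, g (ξ i) ≤ s i) ∧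
      ∀ x ∈ Set.range ξ, ∀ y ∈ Ξ, ℓ y ≤ g x + lam * nrm (x - y) := by
  obtain ⟨g, hgs, hatt⟩ := exists_fiberwise_min ξ s
  refine ⟨g, hgs, Set.forall_mem_range.2 fun i y hy => ?_⟩
  obtain ⟨j, hj, hsj⟩ := hatt i
  rw [← hsj, ← hj, map_sub_rev]
  exact h.2 j y hy

theorem ae_mem_of_map_compl_eq_zero {X Y : Type*} [MeasurableSpace X] [MeasurableSpace Y]
    {μ : Measure X} {f : X → Y} (hf : Measurable f) {s : Set Y} (h : μ.map f sᶜ = 0) :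
    ∀ᵐ x ∂μ, f x ∈ s :=
  ae_of_ae_map (p := (· ∈ s)) hf.aemeasurable (mem_ae_iff.2 h)

theorem integral_le_of_mem_dualFeasible [NeZero N] {lam : ℝ} {s : Fin N → ℝ}
    (hs : (lam, s) ∈ dualFeasible nrm Ξ ξ ℓ) {r : ℝ} (hr : 0 ≤ r) {Q : Measure (Fin m → ℝ)}
    (hQ : Q ∈ wassersteinBall nrm Ξ ξ r) (hℓ : Integrable ℓ Q) :
    ∫ x, ℓ x ∂Q ≤ lam * r + (1 / (N : ℝ)) * ∑ i, s i := by
  obtain ⟨g, hgs, hg⟩ := exists_potential_of_mem_dualFeasible hs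
  have hlam : 0 ≤ lam := hs.1
  have hcoupling (δ : ℝ) (hδ : 0 < δ) :
      ∫ x, ℓ x ∂Q ≤ (1 / (N : ℝ)) * ∑ i, s i + lam * (r + δ) := by
    obtain ⟨π, hfst, hsnd, hcost, hcost_le⟩ := exists_coupling_integral_le hr hQ.2 hδ
    have hatom : ∀ᵐ z ∂π, z.1 ∈ Set.range ξ := ae_mem_of_map_compl_eq_zero measurable_fst
      (hfst ▸ empirical_compl_eq_zero Set.mem_range_self)
    have hsupp : ∀ᵐ z ∂π, z.2 ∈ Ξ :=
      ae_mem_of_map_compl_eq_zero measurable_snd (hsnd ▸ hQ.1.2.1)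
    calc ∫ x, ℓ x ∂Q ≤ ∫ x, g x ∂(empirical ξ) + lam * ∫ z, nrm (z.1 - z.2) ∂π := by
          have hφ := integrable_empirical ξ g
          rw [← hfst] at hφ ⊢
          rw [← hsnd] at hℓ ⊢
          refine integral_map_snd_le_integral_map_fst_add hφ hℓ hcost ?_
          filter_upwards [hatom, hsupp] with z hz₁ hz₂ using hg z.1 hz₁ z.2 hz₂
      _ ≤ (1 / (N : ℝ)) * ∑ i, s i + lam * (r + δ) := by
          rw [integral_empirical]
          gcongr with i
          exact hgs i
  have hlim : Filter.Tendsto (fun δ => (1 / (N : ℝ)) * ∑ i, s i + lam * (r + δ))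
      (nhdsWithin 0 (Set.Ioi 0)) (nhds (lam * r + (1 / (N : ℝ)) * ∑ i, s i)) := by
    refine (Continuous.tendsto' (by fun_prop) 0 _ ?_).mono_left nhdsWithin_le_nhds
    ring
  exact ge_of_tendsto hlim (eventually_mem_nhdsWithin.mono hcoupling)

theorem IsLipschitzFor.mem_dualFeasible (hL : 0 ≤ L) (hℓ : IsLipschitzFor nrm L ℓ) :
    (L, fun i => ℓ (ξ i)) ∈ dualFeasible nrm Ξ ξ ℓ :=
  ⟨hL, fun i x _ => hℓ x (ξ i)⟩

theorem IsLipschitzFor.integral_le [NeZero N] (hL : 0 ≤ L) (hℓ : IsLipschitzFor nrm L ℓ) {r : ℝ}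
    (hr : 0 ≤ r) {Q : Measure (Fin m → ℝ)} (hQ : Q ∈ wassersteinBall nrm Ξ ξ r) :
    ∫ x, ℓ x ∂Q ≤ L * r + (1 / (N : ℝ)) * ∑ i, ℓ (ξ i) :=
  integral_le_of_mem_dualFeasible (hℓ.mem_dualFeasible hL) hr hQ
    (hℓ.integrable_of_mem_firstMomentMeasures hQ.1)

theorem isLUB_worstCaseReal [NeZero N] (hξ : ∀ i, ξ i ∈ Ξ) (hL : 0 ≤ L)
    (hℓ : IsLipschitzFor nrm L ℓ) {r : ℝ} (hr : 0 ≤ r) :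
    IsLUB ((fun Q => ∫ x, ℓ x ∂Q) '' wassersteinBall nrm Ξ ξ r) (worstCaseReal nrm Ξ ξ ℓ r) :=
  isLUB_csSup ⟨_, empirical ξ, empirical_self_mem_wassersteinBall hξ hr, rfl⟩
    ⟨_, Set.forall_mem_image.2 fun _ hQ => hℓ.integral_le hL hr hQ⟩

theorem integral_le_worstCaseReal [NeZero N] (hξ : ∀ i, ξ i ∈ Ξ) (hL : 0 ≤ L)
    (hℓ : IsLipschitzFor nrm L ℓ) {r : ℝ} (hr : 0 ≤ r) {Q : Measure (Fin m → ℝ)}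
    (hQ : Q ∈ wassersteinBall nrm Ξ ξ r) : ∫ x, ℓ x ∂Q ≤ worstCaseReal nrm Ξ ξ ℓ r :=
  (isLUB_worstCaseReal hξ hL hℓ hr).1 ⟨Q, hQ, rfl⟩

theorem coe_worstCaseReal [NeZero N] (hξ : ∀ i, ξ i ∈ Ξ) (hL : 0 ≤ L)
    (hℓ : IsLipschitzFor nrm L ℓ) {r : ℝ} (hr : 0 ≤ r) :
    (worstCaseReal nrm Ξ ξ ℓ r : EReal) = worstCase nrm Ξ ξ r ℓ := by
  have hlub := isLUB_worstCaseReal hξ hL hℓ hr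
  have hne : ((fun Q => ∫ x, ℓ x ∂Q) '' wassersteinBall nrm Ξ ξ r).Nonempty :=
    ⟨_, empirical ξ, empirical_self_mem_wassersteinBall hξ hr, rfl⟩
  rw [worstCaseReal, EReal.coe_strictMono.monotone.map_csSup_of_continuousAt
    continuous_coe_real_ereal.continuousAt hne hlub.bddAbove, sSup_image, iSup_image, worstCase]

theorem monotoneOn_worstCaseReal [NeZero N] (hξ : ∀ i, ξ i ∈ Ξ) (hL : 0 ≤ L)
    (hℓ : IsLipschitzFor nrm L ℓ) : MonotoneOn (worstCaseReal nrm Ξ ξ ℓ) (Set.Ici 0) :=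
  fun _ hr _ hr' hle => (isLUB_worstCaseReal hξ hL hℓ hr).mono
    (isLUB_worstCaseReal hξ hL hℓ hr') (Set.image_mono (wassersteinBall_mono hle))

theorem worstCaseReal_le_add_mul [NeZero N] (hξ : ∀ i, ξ i ∈ Ξ) (hL : 0 ≤ L)
    (hℓ : IsLipschitzFor nrm L ℓ) {r : ℝ} (hr : 0 ≤ r) :
    worstCaseReal nrm Ξ ξ ℓ r ≤ worstCaseReal nrm Ξ ξ ℓ 0 + L * r := by
  have hcenter : (1 / (N : ℝ)) * ∑ i, ℓ (ξ i) ≤ worstCaseReal nrm Ξ ξ ℓ 0 := by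
    rw [← integral_empirical]
    exact integral_le_worstCaseReal hξ hL hℓ le_rfl
      (empirical_self_mem_wassersteinBall hξ le_rfl)
  refine (isLUB_worstCaseReal hξ hL hℓ hr).2 (Set.forall_mem_image.2 fun Q hQ => ?_)
  linarith [hℓ.integral_le hL hr hQ]

theorem concaveOn_worstCaseReal [NeZero N] (hξ : ∀ i, ξ i ∈ Ξ) (hL : 0 ≤ L)
    (hℓ : IsLipschitzFor nrm L ℓ) : ConcaveOn ℝ (Set.Ici 0) (worstCaseReal nrm Ξ ξ ℓ) := by
  refine ⟨convex_Ici 0, fun r₁ hr₁ r₂ hr₂ a b ha hb hab => ?_⟩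
  rw [Set.mem_Ici] at hr₁ hr₂
  refine le_of_forall_pos_sub_le fun δ hδ => ?_
  obtain ⟨_, ⟨Q₁, hQ₁, rfl⟩, hlt₁, -⟩ :=
    (isLUB_worstCaseReal hξ hL hℓ hr₁).exists_between (sub_lt_self _ hδ)
  obtain ⟨_, ⟨Q₂, hQ₂, rfl⟩, hlt₂, -⟩ :=
    (isLUB_worstCaseReal hξ hL hℓ hr₂).exists_between (sub_lt_self _ hδ)
  simp only [smul_eq_mul]
  calc a * worstCaseReal nrm Ξ ξ ℓ r₁ + b * worstCaseReal nrm Ξ ξ ℓ r₂ - δ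
      = a * (worstCaseReal nrm Ξ ξ ℓ r₁ - δ) + b * (worstCaseReal nrm Ξ ξ ℓ r₂ - δ) := by
        linear_combination δ * hab
    _ ≤ a * ∫ x, ℓ x ∂Q₁ + b * ∫ x, ℓ x ∂Q₂ := by gcongr
    _ = ∫ x, ℓ x ∂(mixture a b Q₁ Q₂) := (integral_mixture ha hb
        (hℓ.integrable_of_mem_firstMomentMeasures hQ₁.1)
        (hℓ.integrable_of_mem_firstMomentMeasures hQ₂.1)).symm
    _ ≤ worstCaseReal nrm Ξ ξ ℓ (a * r₁ + b * r₂) :=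
        integral_le_worstCaseReal hξ hL hℓ (by positivity)
          (mixture_mem_wassersteinBall ha hb hab hr₁ hr₂ hQ₁ hQ₂)

theorem exists_mem_dualFeasible_objective_le [NeZero N] (hξ : ∀ i, ξ i ∈ Ξ) (hL : 0 ≤ L)
    (hℓ : IsLipschitzFor nrm L ℓ) {ε : ℝ} (hε : 0 ≤ ε) :
    ∃ (lam : ℝ) (s : Fin N → ℝ), (lam, s) ∈ dualFeasible nrm Ξ ξ ℓ ∧
      lam * ε + (1 / (N : ℝ)) * ∑ i, s i ≤ worstCaseReal nrm Ξ ξ ℓ ε := by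
  have hN : (0 : ℝ) < N := Nat.cast_pos.2 (NeZero.pos N)
  obtain ⟨lam, hlam, hsupergradient⟩ := exists_nonneg_supergradient_of_growth_le
    (concaveOn_worstCaseReal hξ hL hℓ) (monotoneOn_worstCaseReal hξ hL hℓ) hL
    (fun r hr => worstCaseReal_le_add_mul hξ hL hℓ hr) hε
  have hatoms (y : Fin N → Fin m → ℝ) (hy : ∀ i, y i ∈ Ξ) :
      ∑ i, (ℓ (y i) - lam * nrm (y i - ξ i)) ≤ N * (worstCaseReal nrm Ξ ξ ℓ ε - lam * ε) := by
    set r : ℝ := (1 / (N : ℝ)) * ∑ i, nrm (y i - ξ i) with hr_def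
    have hr : 0 ≤ r := by positivity
    have hbound : (1 / (N : ℝ)) * ∑ i, ℓ (y i) ≤
        worstCaseReal nrm Ξ ξ ℓ ε + lam * (r - ε) := by
      rw [← integral_empirical]
      exact (integral_le_worstCaseReal hξ hL hℓ hr (empirical_mem_wassersteinBall ξ hy)).trans
        (hsupergradient r hr)
    rw [Finset.sum_sub_distrib, ← Finset.mul_sum, ← inv_mul_le_iff₀ hN, ← one_div, mul_sub,
      mul_left_comm, ← hr_def]
    linarith
  obtain ⟨s, hs, hsum⟩ :=
    exists_bounds_of_forall_sum_le (φ := fun i x => ℓ x - lam * nrm (x - ξ i)) hξ hatoms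
  refine ⟨lam, s, ⟨hlam, fun i x hx => sub_le_iff_le_add.1 (hs i x hx)⟩, ?_⟩
  rwa [← le_sub_iff_add_le', one_div, inv_mul_le_iff₀ hN]

theorem worstCase_eq_optValue {Y : Type*} [NeZero N] (hξ : ∀ i, ξ i ∈ Ξ) (hL : 0 ≤ L)
    (hℓ : IsLipschitzFor nrm L ℓ) {ε : ℝ} (hε : 0 ≤ ε) {F : Set (ℝ × (Fin N → ℝ) × Y)}
    (hF : ∀ lam s, (∃ y, (lam, s, y) ∈ F) ↔ (lam, s) ∈ dualFeasible nrm Ξ ξ ℓ) :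
    worstCase nrm Ξ ξ ε ℓ = optValue F (objective ε) := by
  apply le_antisymm
  · refine iSup₂_le fun Q hQ => le_iInf₂ fun ⟨lam, s, y⟩ hy => EReal.coe_le_coe_iff.2 ?_
    exact integral_le_of_mem_dualFeasible ((hF lam s).1 ⟨y, hy⟩) hε hQ
      (hℓ.integrable_of_mem_firstMomentMeasures hQ.1)
  · obtain ⟨lam, s, hs, hle⟩ := exists_mem_dualFeasible_objective_le hξ hL hℓ hε
    obtain ⟨y, hy⟩ := (hF lam s).2 hs
    rw [← coe_worstCaseReal hξ hL hℓ hε]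
    exact (iInf₂_le (lam, s, y) hy).trans (EReal.coe_le_coe_iff.2 hle)

end WorstCaseDuality

section Programs

variable {m p N K : ℕ} {nrm : Seminorm ℝ (Fin m → ℝ)} {Ξ : Set (Fin m → ℝ)}
  {C : Matrix (Fin p) (Fin m) ℝ} {d : Fin p → ℝ} {A : Matrix (Fin K) (Fin m) ℝ} {b : Fin K → ℝ}
  {ξ : Fin N → Fin m → ℝ} {ε : ℝ}

theorem exists_isLipschitzFor_rows (hnrm : ∀ x, nrm x = 0 → x = 0) (A : Matrix (Fin K) (Fin m) ℝ) :
    ∃ L : ℝ, 0 ≤ L ∧ ∀ k, IsLipschitzFor nrm L (A k ⬝ᵥ ·) := by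
  choose c hc hA using fun k => exists_abs_le_mul_seminorm hnrm (dotProductEquiv ℝ (Fin m) (A k))
  refine ⟨∑ k, c k, Finset.sum_nonneg fun k _ => hc k, fun k x y => ?_⟩
  rw [← sub_le_iff_le_add', ← dotProduct_sub]
  calc A k ⬝ᵥ (x - y) ≤ c k * nrm (x - y) := (le_abs_self _).trans (hA k (x - y))
    _ ≤ (∑ k, c k) * nrm (x - y) := by
        gcongr
        exact Finset.single_le_sum (fun k _ => hc k) (Finset.mem_univ k)

theorem exists_isLipschitzFor_maxAffine [NeZero K] (hnrm : ∀ x, nrm x = 0 → x = 0)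
    (A : Matrix (Fin K) (Fin m) ℝ) (b : Fin K → ℝ) :
    ∃ L : ℝ, 0 ≤ L ∧ IsLipschitzFor nrm L (maxAffine A b) := by
  obtain ⟨L, hL, hA⟩ := exists_isLipschitzFor_rows hnrm A
  refine ⟨L, hL, fun x y => maxAffine_le_iff.2 fun k => ?_⟩
  linarith [hA k x y, le_maxAffine (A := A) (b := b) k y]

theorem exists_isLipschitzFor_minAffine [NeZero K] (hnrm : ∀ x, nrm x = 0 → x = 0)
    (A : Matrix (Fin K) (Fin m) ℝ) (b : Fin K → ℝ) :
    ∃ L : ℝ, 0 ≤ L ∧ IsLipschitzFor nrm L (minAffine A b) := by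
  obtain ⟨L, hL, hA⟩ := exists_isLipschitzFor_rows hnrm A
  refine ⟨L, hL, fun x y => sub_le_iff_le_add.1 (le_minAffine_iff.2 fun k => ?_)⟩
  linarith [hA k x y, minAffine_le (A := A) (b := b) k x]

theorem integrable_maxAffine [NeZero K] (hnrm : ∀ x, nrm x = 0 → x = 0) {Q : Measure (Fin m → ℝ)}
    (hQ : Q ∈ firstMomentMeasures nrm Ξ) : Integrable (maxAffine A b) Q :=
  have ⟨_, _, hℓ⟩ := exists_isLipschitzFor_maxAffine hnrm A b
  hℓ.integrable_of_mem_firstMomentMeasures hQ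

theorem integrable_minAffine [NeZero K] (hnrm : ∀ x, nrm x = 0 → x = 0) {Q : Measure (Fin m → ℝ)}
    (hQ : Q ∈ firstMomentMeasures nrm Ξ) : Integrable (minAffine A b) Q :=
  have ⟨_, _, hℓ⟩ := exists_isLipschitzFor_minAffine hnrm A b
  hℓ.integrable_of_mem_firstMomentMeasures hQ

theorem exists_mem_maxFeasible_iff [NeZero N] [NeZero K] (hnrm : ∀ x, nrm x = 0 → x = 0)
    (hξ : ∀ i, ξ i ∈ polytope C d) (lam : ℝ) (s : Fin N → ℝ) :
    (∃ γ, (lam, s, γ) ∈ maxFeasible nrm C d A b ξ) ↔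
      (lam, s) ∈ dualFeasible nrm (polytope C d) ξ (maxAffine A b) := by
  have hpiece (i : Fin N) (k : Fin K) :=
    exists_multipliers_affine_iff hnrm (a := A k) (β := b k) (hξ i) (lam := lam) (v := s i)
  constructor
  · rintro ⟨γ, hval, hdual, hγ⟩
    have h (i : Fin N) (k : Fin K) := (hpiece i k).1 ⟨γ i k, hval i k, hdual i k, hγ i k⟩
    exact ⟨(h 0 0).1, fun i x hx => maxAffine_le_iff.2 fun k => (h i k).2 x hx⟩
  · rintro ⟨hlam, h⟩
    choose γ hval hdual hγ using fun i k =>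
      (hpiece i k).2 ⟨hlam, fun x hx => (le_maxAffine k x).trans (h i x hx)⟩
    exact ⟨γ, hval, hdual, hγ⟩

theorem exists_mem_minFeasible_iff [NeZero N] [NeZero K] (hnrm : ∀ x, nrm x = 0 → x = 0)
    (hξ : ∀ i, ξ i ∈ polytope C d) (lam : ℝ) (s : Fin N → ℝ) :
    (∃ y, (lam, s, y) ∈ minFeasible nrm C d A b ξ) ↔
      (lam, s) ∈ dualFeasible nrm (polytope C d) ξ (minAffine A b) := by
  have hatom (i : Fin N) :=
    exists_multipliers_minAffine_iff hnrm (A := A) (b := b) (hξ i) (lam := lam) (v := s i)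
  constructor
  · rintro ⟨⟨γ, θ⟩, hval, hdual, hθ1, hγ, hθ⟩
    have h (i : Fin N) := (hatom i).1 ⟨γ i, θ i, hval i, hdual i, hθ1 i, hγ i, hθ i⟩
    exact ⟨(h 0).1, fun i => (h i).2⟩
  · rintro ⟨hlam, h⟩
    choose γ θ hval hdual hθ1 hγ hθ using fun i => (hatom i).2 ⟨hlam, h i⟩
    exact ⟨(γ, θ), hval, hdual, hθ1, hγ, hθ⟩

theorem worstCase_maxAffine [NeZero N] [NeZero K] (hnrm : ∀ x, nrm x = 0 → x = 0)
    (hξ : ∀ i, ξ i ∈ polytope C d) (hε : 0 ≤ ε) :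
    worstCase nrm (polytope C d) ξ ε (maxAffine A b) =
      optValue (maxFeasible nrm C d A b ξ) (objective ε) := by
  obtain ⟨L, hL, hℓ⟩ := exists_isLipschitzFor_maxAffine hnrm A b
  exact worstCase_eq_optValue hξ hL hℓ hε (exists_mem_maxFeasible_iff hnrm hξ)

theorem worstCase_minAffine [NeZero N] [NeZero K] (hnrm : ∀ x, nrm x = 0 → x = 0)
    (hξ : ∀ i, ξ i ∈ polytope C d) (hε : 0 ≤ ε) :
    worstCase nrm (polytope C d) ξ ε (minAffine A b) =
      optValue (minFeasible nrm C d A b ξ) (objective ε) := by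
  obtain ⟨L, hL, hℓ⟩ := exists_isLipschitzFor_minAffine hnrm A b
  exact worstCase_eq_optValue hξ hL hℓ hε (exists_mem_minFeasible_iff hnrm hξ)

end Programs

section LinearPrograms

variable {m p N K : ℕ} {nrm : Seminorm ℝ (Fin m → ℝ)} {C : Matrix (Fin p) (Fin m) ℝ}
  {d : Fin p → ℝ} {A : Matrix (Fin K) (Fin m) ℝ} {b : Fin K → ℝ} {ξ : Fin N → Fin m → ℝ} {ε : ℝ}

theorem forall_sgn_mul_le_iff {x y : ℝ} : (∀ σ, sgn σ * x ≤ y) ↔ |x| ≤ y := by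
  simp only [Bool.forall_bool, sgn, Bool.false_eq_true, if_false, if_true, one_mul, neg_one_mul,
    abs_le', and_comm]

theorem forall_sgn_mul_le_add_iff {x a y : ℝ} :
    (∀ σ, sgn σ * x ≤ sgn σ * a + y) ↔ |x - a| ≤ y := by
  simp only [← forall_sgn_mul_le_iff, mul_sub, sub_le_iff_le_add']

theorem forall_sgn_mul_le_sgn_iff {x : ℝ} : (∀ σ, sgn σ * x ≤ sgn σ) ↔ x = 1 := by
  simp only [Bool.forall_bool, sgn, Bool.false_eq_true, if_false, if_true, one_mul, neg_one_mul,
    neg_le_neg_iff, le_antisymm_iff (a := x), and_comm]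

theorem mem_feasible_maxLPOne_iff {lam : ℝ} {s : Fin N → ℝ} {γ : Fin N → Fin K → Fin p → ℝ} :
    (lam, s, γ) ∈ (maxLPOne C d A b ξ ε).feasible ↔
      (∀ i k, b k + A k ⬝ᵥ ξ i + γ i k ⬝ᵥ (d - C *ᵥ ξ i) ≤ s i) ∧
      (∀ i k l, |(Cᵀ *ᵥ γ i k - A k) l| ≤ lam) ∧ (∀ i k, 0 ≤ γ i k) ∧ 0 ≤ lam := by
  change (maxLPOne C d A b ξ ε).lhs (lam, s, γ) ≤ (maxLPOne C d A b ξ ε).rhs ↔ _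
  simp only [maxLPOne, LinearMap.coe_mk, AddHom.coe_mk, Pi.le_def, Sum.forall, Prod.forall,
    forall_sgn_mul_le_add_iff, neg_nonpos, Pi.zero_apply, Pi.sub_apply, forall_const,
    sub_le_iff_le_add, le_neg_add_iff_add_le]

theorem mem_feasible_maxLPInf_iff {lam : ℝ} {s : Fin N → ℝ} {γ : Fin N → Fin K → Fin p → ℝ}
    {u : Fin N → Fin K → Fin m → ℝ} :
    ((lam, s, γ), u) ∈ (maxLPInf C d A b ξ ε).feasible ↔
      (∀ i k, b k + A k ⬝ᵥ ξ i + γ i k ⬝ᵥ (d - C *ᵥ ξ i) ≤ s i) ∧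
      (∀ i k l, |(Cᵀ *ᵥ γ i k - A k) l| ≤ u i k l) ∧ (∀ i k, 0 ≤ γ i k) ∧
      ∀ i k, ∑ l, u i k l ≤ lam := by
  change (maxLPInf C d A b ξ ε).lhs ((lam, s, γ), u) ≤ (maxLPInf C d A b ξ ε).rhs ↔ _
  simp only [maxLPInf, LinearMap.coe_mk, AddHom.coe_mk, Pi.le_def, Sum.forall, Prod.forall,
    forall_sgn_mul_le_add_iff, neg_nonpos, Pi.zero_apply, Pi.sub_apply, sub_le_iff_le_add,
    le_neg_add_iff_add_le, zero_add]

theorem mem_feasible_minLPOne_iff {lam : ℝ} {s : Fin N → ℝ} {γ : Fin N → Fin p → ℝ}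
    {θ : Fin N → Fin K → ℝ} :
    (lam, s, γ, θ) ∈ (minLPOne C d A b ξ ε).feasible ↔
      (∀ i, θ i ⬝ᵥ (b + A *ᵥ ξ i) + γ i ⬝ᵥ (d - C *ᵥ ξ i) ≤ s i) ∧
      (∀ i l, |(Cᵀ *ᵥ γ i - Aᵀ *ᵥ θ i) l| ≤ lam) ∧ (∀ i, θ i ⬝ᵥ 1 = 1) ∧ (∀ i, 0 ≤ γ i) ∧
      (∀ i, 0 ≤ θ i) ∧ 0 ≤ lam := by
  change (minLPOne C d A b ξ ε).lhs (lam, s, γ, θ) ≤ (minLPOne C d A b ξ ε).rhs ↔ _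
  simp only [minLPOne, LinearMap.coe_mk, AddHom.coe_mk, Pi.le_def, Sum.forall, Prod.forall,
    sub_nonpos, forall_sgn_mul_le_iff, forall_sgn_mul_le_sgn_iff, neg_nonpos, Pi.zero_apply,
    forall_const]

theorem mem_feasible_minLPInf_iff {lam : ℝ} {s : Fin N → ℝ} {γ : Fin N → Fin p → ℝ}
    {θ : Fin N → Fin K → ℝ} {u : Fin N → Fin m → ℝ} :
    ((lam, s, γ, θ), u) ∈ (minLPInf C d A b ξ ε).feasible ↔
      (∀ i, θ i ⬝ᵥ (b + A *ᵥ ξ i) + γ i ⬝ᵥ (d - C *ᵥ ξ i) ≤ s i) ∧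
      (∀ i l, |(Cᵀ *ᵥ γ i - Aᵀ *ᵥ θ i) l| ≤ u i l) ∧ (∀ i, θ i ⬝ᵥ 1 = 1) ∧ (∀ i, 0 ≤ γ i) ∧
      (∀ i, 0 ≤ θ i) ∧ ∀ i, ∑ l, u i l ≤ lam := by
  change (minLPInf C d A b ξ ε).lhs ((lam, s, γ, θ), u) ≤ (minLPInf C d A b ξ ε).rhs ↔ _
  simp only [minLPInf, LinearMap.coe_mk, AddHom.coe_mk, Pi.le_def, Sum.forall, Prod.forall,
    sub_nonpos, forall_sgn_mul_le_iff, forall_sgn_mul_le_sgn_iff, neg_nonpos, Pi.zero_apply]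

theorem feasible_maxLPOne [NeZero N] [NeZero K] (hone : ∀ x, nrm x = ∑ l, |x l|) :
    (maxLPOne C d A b ξ ε).feasible = maxFeasible nrm C d A b ξ := by
  ext ⟨lam, s, γ⟩
  rw [mem_feasible_maxLPOne_iff]
  constructor
  · rintro ⟨hval, hentry, hγ, hlam⟩
    exact ⟨hval, fun i k => (dualNorm_le_iff_of_eq_sum_abs hone).2 ⟨hlam, hentry i k⟩, hγ⟩
  · rintro ⟨hval, hdual, hγ⟩
    have h (i : Fin N) (k : Fin K) := (dualNorm_le_iff_of_eq_sum_abs hone).1 (hdual i k)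
    exact ⟨hval, fun i k => (h i k).2, hγ, (h 0 0).1⟩

theorem image_feasible_maxLPInf (hsup : ∀ x, nrm x = ⨆ l, |x l|) :
    Prod.fst '' (maxLPInf C d A b ξ ε).feasible = maxFeasible nrm C d A b ξ := by
  refine subset_antisymm ?_ ?_
  · rintro _ ⟨⟨⟨lam, s, γ⟩, u⟩, h, rfl⟩
    obtain ⟨hval, hentry, hγ, hsum⟩ := mem_feasible_maxLPInf_iff.1 h
    exact ⟨hval, fun i k => (dualNorm_le_iff_of_eq_iSup_abs hsup).2
      ((Finset.sum_le_sum fun l _ => hentry i k l).trans (hsum i k)), hγ⟩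
  · rintro ⟨lam, s, γ⟩ ⟨hval, hdual, hγ⟩
    exact ⟨((lam, s, γ), fun i k l => |(Cᵀ *ᵥ γ i k - A k) l|), mem_feasible_maxLPInf_iff.2
      ⟨hval, fun _ _ _ => le_rfl, hγ, fun i k => (dualNorm_le_iff_of_eq_iSup_abs hsup).1
        (hdual i k)⟩, rfl⟩

theorem feasible_minLPOne [NeZero N] (hone : ∀ x, nrm x = ∑ l, |x l|) :
    (minLPOne C d A b ξ ε).feasible = minFeasible nrm C d A b ξ := by
  ext ⟨lam, s, γ, θ⟩
  rw [mem_feasible_minLPOne_iff]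
  constructor
  · rintro ⟨hval, hentry, hθ1, hγ, hθ, hlam⟩
    exact ⟨hval, fun i => (dualNorm_le_iff_of_eq_sum_abs hone).2 ⟨hlam, hentry i⟩, hθ1, hγ, hθ⟩
  · rintro ⟨hval, hdual, hθ1, hγ, hθ⟩
    have h (i : Fin N) := (dualNorm_le_iff_of_eq_sum_abs hone).1 (hdual i)
    exact ⟨hval, fun i => (h i).2, hθ1, hγ, hθ, (h 0).1⟩

theorem image_feasible_minLPInf (hsup : ∀ x, nrm x = ⨆ l, |x l|) :
    Prod.fst '' (minLPInf C d A b ξ ε).feasible = minFeasible nrm C d A b ξ := by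
  refine subset_antisymm ?_ ?_
  · rintro _ ⟨⟨⟨lam, s, γ, θ⟩, u⟩, h, rfl⟩
    obtain ⟨hval, hentry, hθ1, hγ, hθ, hsum⟩ := mem_feasible_minLPInf_iff.1 h
    exact ⟨hval, fun i => (dualNorm_le_iff_of_eq_iSup_abs hsup).2
      ((Finset.sum_le_sum fun l _ => hentry i l).trans (hsum i)), hθ1, hγ, hθ⟩
  · rintro ⟨lam, s, γ, θ⟩ ⟨hval, hdual, hθ1, hγ, hθ⟩
    exact ⟨((lam, s, γ, θ), fun i l => |(Cᵀ *ᵥ γ i - Aᵀ *ᵥ θ i) l|), mem_feasible_minLPInf_iff.2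
      ⟨hval, fun _ _ => le_rfl, hθ1, hγ, hθ, fun i => (dualNorm_le_iff_of_eq_iSup_abs hsup).1
        (hdual i)⟩, rfl⟩

theorem LinearProgram.value_eq_optValue {E R E' : Type} [AddCommGroup E] [Module ℝ E]
    (P : LinearProgram E R) {g : E → E'} {F : Set E'} {f : E' → ℝ} (hF : g '' P.feasible = F)
    (hcost : ∀ x, P.cost x = f (g x)) : P.value = optValue F f := by
  simp only [LinearProgram.value, optValue, ← hF, iInf_image, hcost]

theorem value_maxLPOne [NeZero N] [NeZero K] (hone : ∀ x, nrm x = ∑ l, |x l|) :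
    (maxLPOne C d A b ξ ε).value = optValue (maxFeasible nrm C d A b ξ) (objective ε) :=
  congrArg (optValue · (objective ε)) (feasible_maxLPOne hone)

theorem value_maxLPInf (hsup : ∀ x, nrm x = ⨆ l, |x l|) :
    (maxLPInf C d A b ξ ε).value = optValue (maxFeasible nrm C d A b ξ) (objective ε) :=
  (maxLPInf C d A b ξ ε).value_eq_optValue (image_feasible_maxLPInf hsup) fun _ => rfl

theorem value_minLPOne [NeZero N] (hone : ∀ x, nrm x = ∑ l, |x l|) :
    (minLPOne C d A b ξ ε).value = optValue (minFeasible nrm C d A b ξ) (objective ε) :=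
  congrArg (optValue · (objective ε)) (feasible_minLPOne hone)

theorem value_minLPInf (hsup : ∀ x, nrm x = ⨆ l, |x l|) :
    (minLPInf C d A b ξ ε).value = optValue (minFeasible nrm C d A b ξ) (objective ε) :=
  (minLPInf C d A b ξ ε).value_eq_optValue (image_feasible_minLPInf hsup) fun _ => rfl

theorem finrank_maxVars : Module.finrank ℝ (MaxVars N K p) = 1 + N + N * K * p := by
  simp only [Module.finrank_prod, Module.finrank_self, Module.finrank_pi_fintype, Finset.sum_const,
    Finset.card_univ, Fintype.card_fin, smul_eq_mul]
  ring

theorem finrank_minVars : Module.finrank ℝ (MinVars N K p) = 1 + N * (1 + p + K) := by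
  simp only [Module.finrank_prod, Module.finrank_self, Module.finrank_pi_fintype, Finset.sum_const,
    Finset.card_univ, Fintype.card_fin, smul_eq_mul]
  ring

theorem numVars_maxLPInf : (maxLPInf C d A b ξ ε).numVars = 1 + N + N * K * (p + m) := by
  simp only [LinearProgram.numVars, Module.finrank_prod (M := MaxVars N K p), finrank_maxVars,
    Module.finrank_pi_fintype, Module.finrank_self, Finset.sum_const, Finset.card_univ,
    Fintype.card_fin, smul_eq_mul]
  ring

theorem numVars_minLPInf : (minLPInf C d A b ξ ε).numVars = 1 + N * (1 + p + K + m) := by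
  simp only [LinearProgram.numVars, Module.finrank_prod (M := MinVars N K p), finrank_minVars,
    Module.finrank_pi_fintype, Module.finrank_self, Finset.sum_const, Finset.card_univ,
    Fintype.card_fin, smul_eq_mul]
  ring

theorem numCons_maxLPOne : (maxLPOne C d A b ξ ε).numCons = N * K * (1 + 2 * m + p) + 1 := by
  simp only [LinearProgram.numCons, Nat.card_eq_fintype_card, Fintype.card_sum, Fintype.card_prod,
    Fintype.card_fin, Fintype.card_bool, Fintype.card_unit]
  ring

theorem numCons_maxLPInf : (maxLPInf C d A b ξ ε).numCons = N * K * (2 + 2 * m + p) := by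
  simp only [LinearProgram.numCons, Nat.card_eq_fintype_card, Fintype.card_sum, Fintype.card_prod,
    Fintype.card_fin, Fintype.card_bool]
  ring

theorem numCons_minLPOne : (minLPOne C d A b ξ ε).numCons = N * (3 + 2 * m + p + K) + 1 := by
  simp only [LinearProgram.numCons, Nat.card_eq_fintype_card, Fintype.card_sum, Fintype.card_prod,
    Fintype.card_fin, Fintype.card_bool, Fintype.card_unit]
  ring

theorem numCons_minLPInf : (minLPInf C d A b ξ ε).numCons = N * (4 + 2 * m + p + K) := by
  simp only [LinearProgram.numCons, Nat.card_eq_fintype_card, Fintype.card_sum, Fintype.card_prod,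
    Fintype.card_fin, Fintype.card_bool]
  ring

end LinearPrograms

end WassersteinDRO

theorem mainTheorem6 {m p N K : ℕ} (hN : 0 < N) (hK : 0 < K)
    (nrm : Seminorm ℝ (Fin m → ℝ)) (hnrm : ∀ x, nrm x = 0 → x = 0)
    (C : Matrix (Fin p) (Fin m) ℝ) (d : Fin p → ℝ)
    (A : Matrix (Fin K) (Fin m) ℝ) (b : Fin K → ℝ)
    (ξ : Fin N → Fin m → ℝ) (hξ : ∀ i, ξ i ∈ polytope C d)
    (ε : ℝ) (hε : 0 ≤ ε) :
    -- the maximum of affine functions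
    ((∀ Q ∈ wassersteinBall nrm (polytope C d) ξ ε, Integrable (maxAffine A b) Q) ∧
      worstCase nrm (polytope C d) ξ ε (maxAffine A b) =
        optValue (maxFeasible nrm C d A b ξ) (objective ε) ∧
      -- for the 1-norm, the program is a linear program
      ((∀ x, nrm x = ∑ l, |x l|) →
        (maxLPOne C d A b ξ ε).feasible = maxFeasible nrm C d A b ξ ∧
        (∀ x, (maxLPOne C d A b ξ ε).cost x = objective ε x) ∧
        worstCase nrm (polytope C d) ξ ε (maxAffine A b) = (maxLPOne C d A b ξ ε).value ∧
        (maxLPOne C d A b ξ ε).numVars = 1 + N + N * K * p ∧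
        (maxLPOne C d A b ξ ε).numCons = N * K * (1 + 2 * m + p) + 1) ∧
      -- for the ∞-norm, the program is the projection of a linear program
      ((∀ x, nrm x = ⨆ l, |x l|) →
        Prod.fst '' (maxLPInf C d A b ξ ε).feasible = maxFeasible nrm C d A b ξ ∧
        (∀ x, (maxLPInf C d A b ξ ε).cost x = objective ε x.1) ∧
        worstCase nrm (polytope C d) ξ ε (maxAffine A b) = (maxLPInf C d A b ξ ε).value ∧
        (maxLPInf C d A b ξ ε).numVars = 1 + N + N * K * (p + m) ∧
        (maxLPInf C d A b ξ ε).numCons = N * K * (2 + 2 * m + p))) ∧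
    -- the minimum of affine functions
    ((∀ Q ∈ wassersteinBall nrm (polytope C d) ξ ε, Integrable (minAffine A b) Q) ∧
      worstCase nrm (polytope C d) ξ ε (minAffine A b) =
        optValue (minFeasible nrm C d A b ξ) (objective ε) ∧
      ((∀ x, nrm x = ∑ l, |x l|) →
        (minLPOne C d A b ξ ε).feasible = minFeasible nrm C d A b ξ ∧
        (∀ x, (minLPOne C d A b ξ ε).cost x = objective ε x) ∧
        worstCase nrm (polytope C d) ξ ε (minAffine A b) = (minLPOne C d A b ξ ε).value ∧
        (minLPOne C d A b ξ ε).numVars = 1 + N * (1 + p + K) ∧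
        (minLPOne C d A b ξ ε).numCons = N * (3 + 2 * m + p + K) + 1) ∧
      ((∀ x, nrm x = ⨆ l, |x l|) →
        Prod.fst '' (minLPInf C d A b ξ ε).feasible = minFeasible nrm C d A b ξ ∧
        (∀ x, (minLPInf C d A b ξ ε).cost x = objective ε x.1) ∧
        worstCase nrm (polytope C d) ξ ε (minAffine A b) = (minLPInf C d A b ξ ε).value ∧
        (minLPInf C d A b ξ ε).numVars = 1 + N * (1 + p + K + m) ∧
        (minLPInf C d A b ξ ε).numCons = N * (4 + 2 * m + p + K))) := by
  have : NeZero N := ⟨hN.ne'⟩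
  have : NeZero K := ⟨hK.ne'⟩
  have hmax := worstCase_maxAffine (A := A) (b := b) hnrm hξ hε
  have hmin := worstCase_minAffine (A := A) (b := b) hnrm hξ hε
  refine ⟨⟨fun Q hQ => integrable_maxAffine hnrm hQ.1, hmax, fun hone => ?_, fun hsup => ?_⟩,
    ⟨fun Q hQ => integrable_minAffine hnrm hQ.1, hmin, fun hone => ?_, fun hsup => ?_⟩⟩
  · exact ⟨feasible_maxLPOne hone, fun _ => rfl, hmax.trans (value_maxLPOne hone).symm,
      finrank_maxVars, numCons_maxLPOne⟩
  · exact ⟨image_feasible_maxLPInf hsup, fun _ => rfl, hmax.trans (value_maxLPInf hsup).symm,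
      numVars_maxLPInf, numCons_maxLPInf⟩
  · exact ⟨feasible_minLPOne hone, fun _ => rfl, hmin.trans (value_minLPOne hone).symm,
      finrank_minVars, numCons_minLPOne⟩
  · exact ⟨image_feasible_minLPInf hsup, fun _ => rfl, hmin.trans (value_minLPInf hsup).symm,
      numVars_minLPInf, numCons_minLPInf⟩
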